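/- Let $s\ge 1$, $p_2=2s+1$, $r_2=s$, $s+1\le p_1\le 2s+1$, $r_1=p_1-1$, and let $k\ge\max\{2(s+1)-p_1,\,2\}$, $h=\frac1{k+1}$. For $\ell=1,2$ put $n_\ell=p_\ell+1+k(p_\ell-r_\ell)$ and let $N_0^{p_\ell,r_\ell},\dots,N_{n_\ell-1}^{p_\ell,r_\ell}$ be the B-splines of degree $p_\ell$ on $[0,1]$ for the open knot vector $(\xi^{(\ell)}_0,\dots,\xi^{(\ell)}_{n_\ell+p_\ell})$ in which $0$ and $1$ occur $p_\ell+1$ times each and every inner knot $\frac{m}{k+1}$, $1\le m\le k$, occurs $p_\ell-r_\ell$ times. Each $N_i^{p_1,r_1}$, $0\le i\le n_1-1$, has a unique representation $N_i^{p_1,r_1}=\sum_{j=0}^{n_2-1}\mu_j^{(i)}N_j^{p_2,r_2}$ on $[0,1]$; let $\overline N_i^{\,p_1,r_1}=\sum_{j=s+1}^{n_2-s-2}\mu_j^{(i)}N_j^{p_2,r_2}$ be its truncation, and write $N_{j_1,j_2}^{p_\ell,r_\ell}(x,y)=N_{j_1}^{p_\ell,r_\ell}(x)N_{j_2}^{p_\ell,r_\ell}(y)$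 and $\overline N_{j_1,j_2}^{\,p_1,r_1}(x,y)=\overline N_{j_1}^{\,p_1,r_1}(x)\overline N_{j_2}^{\,p_1,r_1}(y)$. The basis functions of the mixed degree and regularity spline space $\mathcal S_1\oplus\overline{\mathcal S}_1\oplus\mathcal S_2$ on $[0,1]^2$ are the following functions: - ($\mathcal S_1$) $N_{j_1,j_2}^{p_1,r_1}$ with $s+1\le j_1,j_2\le n_1-s-2$; - ($\overline{\mathcal S}_1$) $\overline N_{j_1,j_2}^{\,p_1,r_1}$ with $1\le j_1,j_2\le n_1-2$ for which $j_1$ and $j_2$ are not both in $\{s+1,\dots,n_1-s-2\}$; - ($\mathcal S_2$) $N_{j_1,j_2}^{p_2,r_2}$ with $0\le j_1,j_2\le n_2-1$ for which $j_1$ and $j_2$ are not both in $\{s+1,\dots,n_2-s-2\}$. All these basis functions have local support: the function with index $(j_1,j_2)$ is supported in the box $[\xi^{(\ell)}_{j_1},\xi^{(\ell)}_{j_1+p_\ell+1}]\times[\xi^{(\ell)}_{j_2},\xi^{(\ell)}_{j_2+p_\ell+1}]$, with $\ell=1$ for $\mathcal S_1$ and $\overline{\mathcal S}_1$ and $\ell=2$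 for $\mathcal S_2$, whose sides have length at most $(p_\ell+1)h$. All of them are nonnegative on $[0,1]^2$, and their sum is $1$ at every point of $[0,1]^2$. -/

import Mathlib

noncomputable section

namespace MixedSpline

/-- The `i`-th entry (counted from `0`) of the open knot vector on `[0,1]` with `k` uniform inner
knots: `0` and `1` occur `p + 1` times each, and every inner knot `m / (k + 1)`, `1 ≤ m ≤ k`, occurs
`p - r` times (used with `r < p`). Entries past the end of the vector are never used. -/
def knot (p r k i : ℕ) : ℝ :=
  if i ≤ p then 0
  else if i < p + 1 + k * (p - r) then (((i - (p + 1)) / (p - r) + 1 : ℕ) : ℝ) / ((k : ℝ) + 1)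
  else 1

/-- The Cox-de Boor recursion for the B-spline with index `i` and degree `q` over the knot sequence
`t`, whose last knot value is `1`. Quotients with denominator zero count as zero, and the last
nonempty knot span is closed on the right, so that the functions are B-splines on the closed
interval `[0,1]`. They are zero outside of it. -/
def coxDeBoor (t : ℕ → ℝ) : ℕ → ℕ → ℝ → ℝ
  | 0, i, x =>
      open Classical in
      if (t i ≤ x ∧ x < t (i + 1)) ∨ (t i < 1 ∧ t (i + 1) = 1 ∧ x = 1) then 1 else 0
  | q + 1, i, x =>
      (x - t i) / (t (i + q + 1) - t i) * coxDeBoor t q i x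
        + (t (i + q + 2) - x) / (t (i + q + 2) - t (i + 1)) * coxDeBoor t q (i + 1) x

/-- The univariate B-spline `N_i^{p,r}`. -/
def N (p r k i : ℕ) : ℝ → ℝ := coxDeBoor (knot p r k) p i

/-- The number `n_{p,r} = p + 1 + k (p - r)` of the B-splines `N_i^{p,r}`, `0 ≤ i < n_{p,r}`. -/
def num (p r k : ℕ) : ℕ := p + 1 + k * (p - r)

/-- The tensor-product B-spline `N_{j₁,j₂}^{p,r}`. -/
def N2 (p r k : ℕ) (j : ℕ × ℕ) : ℝ × ℝ → ℝ := fun x => N p r k j.1 x.1 * N p r k j.2 x.2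

/-- `c` is the sequence of coefficients (continued by zero) in the representation
`N_i^{p₁,r₁} = ∑_j c_j N_j^{p₂,r₂}` on `[0,1]`. -/
def IsExpansion (p₁ r₁ p₂ r₂ k i : ℕ) (c : ℕ → ℝ) : Prop :=
  (∀ x ∈ Set.Icc (0 : ℝ) 1, N p₁ r₁ k i x = ∑ j ∈ Finset.range (num p₂ r₂ k), c j * N p₂ r₂ k j x) ∧
    ∀ j, num p₂ r₂ k ≤ j → c j = 0

open Classical in
/-- The coefficients `μ_j^{(i)}` of `N_i^{p₁,r₁}` with respect to the B-splines `N_j^{p₂,r₂}`.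
(Zero if there is no representation; the theorem asserts that there is exactly one.) -/
def mu (p₁ r₁ p₂ r₂ k i : ℕ) : ℕ → ℝ :=
  if h : ∃ c, IsExpansion p₁ r₁ p₂ r₂ k i c then h.choose else 0

/-- The truncated B-spline `∑_{j = s+1}^{n₂-s-2} μ_j^{(i)} N_j^{p₂,r₂}`. -/
def Ntrunc (s p₁ r₁ p₂ r₂ k i : ℕ) : ℝ → ℝ := fun x =>
  ∑ j ∈ Finset.Icc (s + 1) (num p₂ r₂ k - s - 2), mu p₁ r₁ p₂ r₂ k i j * N p₂ r₂ k j x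

/-- The tensor-product truncated B-spline. -/
def Ntrunc2 (s p₁ r₁ p₂ r₂ k : ℕ) (j : ℕ × ℕ) : ℝ × ℝ → ℝ := fun x =>
  Ntrunc s p₁ r₁ p₂ r₂ k j.1 x.1 * Ntrunc s p₁ r₁ p₂ r₂ k j.2 x.2

/-- Indices of the B-splines that span `S₁`; here `n = n_{p₁,r₁}`. -/
def indexS1 (s n : ℕ) : Finset (ℕ × ℕ) :=
  Finset.Icc (s + 1) (n - s - 2) ×ˢ Finset.Icc (s + 1) (n - s - 2)

/-- Indices of the truncated B-splines that span the truncated space; here `n = n_{p₁,r₁}`. -/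
def indexTrunc (s n : ℕ) : Finset (ℕ × ℕ) :=
  (Finset.Icc 1 s ∪ Finset.Icc (n - s - 1) (n - 2)) ×ˢ Finset.Icc 1 (n - 2) ∪
    Finset.Icc (s + 1) (n - s - 2) ×ˢ (Finset.Icc 1 s ∪ Finset.Icc (n - s - 1) (n - 2))

/-- Indices of the B-splines that span `S₂`; here `n = n_{p₂,r₂}`. -/
def indexS2 (s n : ℕ) : Finset (ℕ × ℕ) :=
  (Finset.Icc 0 s ∪ Finset.Icc (n - s - 1) (n - 1)) ×ˢ Finset.Icc 0 (n - 1) ∪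
    Finset.Icc (s + 1) (n - s - 2) ×ˢ (Finset.Icc 0 s ∪ Finset.Icc (n - s - 1) (n - 1))

/-- Index type of the basis of the mixed space: the generators of `S₁`, the truncated B-splines,
and the generators of `S₂`. -/
abbrev BasisIndex (s p₁ r₁ p₂ r₂ k : ℕ) : Type :=
  indexS1 s (num p₁ r₁ k) ⊕ indexTrunc s (num p₁ r₁ k) ⊕ indexS2 s (num p₂ r₂ k)

/-- The basis functions of the mixed degree and regularity spline space, continued by zero
outside of `[0,1]²`. -/
def basisFun (s p₁ r₁ p₂ r₂ k : ℕ) : BasisIndex s p₁ r₁ p₂ r₂ k → ℝ × ℝ → ℝ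
  | .inl j => N2 p₁ r₁ k j.1
  | .inr (.inl j) => Ntrunc2 s p₁ r₁ p₂ r₂ k j.1
  | .inr (.inr j) => N2 p₂ r₂ k j.1

/-- Local support of a function attached to the B-spline `N_{j₁,j₂}^{p,r}`: the support lies in the
knot box of that B-spline, whose sides are at most `p + 1` mesh sizes `1 / (k + 1)` long. -/
def HasLocalSupport (p r k : ℕ) (j : ℕ × ℕ) (f : ℝ × ℝ → ℝ) : Prop :=
  tsupport f ⊆ Set.Icc (knot p r k j.1) (knot p r k (j.1 + p + 1)) ×ˢ
      Set.Icc (knot p r k j.2) (knot p r k (j.2 + p + 1)) ∧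
    knot p r k (j.1 + p + 1) - knot p r k j.1 ≤ ((p : ℝ) + 1) / ((k : ℝ) + 1) ∧
    knot p r k (j.2 + p + 1) - knot p r k j.2 ≤ ((p : ℝ) + 1) / ((k : ℝ) + 1)

/-- Local support of a basis function: a B-spline or a truncated B-spline is supported in the
knot box of the (untruncated) B-spline. -/
def BasisLocalSupport (s p₁ r₁ p₂ r₂ k : ℕ) : BasisIndex s p₁ r₁ p₂ r₂ k → Prop
  | .inl j => HasLocalSupport p₁ r₁ k j.1 (basisFun s p₁ r₁ p₂ r₂ k (.inl j))
  | .inr (.inl j) => HasLocalSupport p₁ r₁ k j.1 (basisFun s p₁ r₁ p₂ r₂ k (.inr (.inl j)))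
  | .inr (.inr j) => HasLocalSupport p₂ r₂ k j.1 (basisFun s p₁ r₁ p₂ r₂ k (.inr (.inr j)))

end MixedSpline

end

namespace MixedSpline

/-! The partition of unity comes from a product structure. The `S₂` functions lack only the inner
square of degree `2 s + 1` B-splines, so the remaining functions must sum to that square. Both
univariate families sum to 1, hence by linear independence the coefficients satisfy `∑ᵢ μⱼ⁽ⁱ⁾ = 1`
(`sum_mu`). Truncation annihilates the first and last B-spline (`mu_boundary`) and does not change,
on `[0,1]`, those generating `S₁` (`Ntrunc_eq_N`). So the `S₁` and truncated functions together form
a full tensor product, whose univariate sums are the inner sums of degree `2 s + 1` (`sum_Ntrunc`).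

Nonnegativity and local support reduce to the sign and the support of `μ`, which are read off from
divided differences. A B-spline is a scaled divided difference of a truncated power
(`coxDeBoor_eq_divDiff`). Divided differences are kept purely algebraic, as a coefficient of a
remainder modulo the nodal polynomial, and the truncated power is replaced by `e * (X - x) ^ q`,
where the polynomial `e` has the Taylor data of a step function at the grid points (`exists_isCut`).
Repeated knots then need no limits.

A derivative under a divided difference becomes a sum over repeated nodes
(`sum_divDiff_cons_eq_divDiff_derivative`), and a divided difference at scattered knots is a
nonnegative combination of those at consecutive knots (`divDiff_nodes_mem_windowCone`). Together
they give nonnegative, locally supported coefficients (`exists_nonneg_expansion`). Uniqueness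
follows from dual polynomials (`IsCut.divDiff_dual`). -/

open Polynomial

/-! ### Divided differences with repeated nodes -/

/-- The monic polynomial whose roots are the entries of `T`. -/
noncomputable def nodal (T : Multiset ℝ) : ℝ[X] := (T.map fun t => X - C t).prod

@[simp] lemma nodal_zero : nodal 0 = 1 := by simp [nodal]

@[simp] lemma nodal_cons (a : ℝ) (T : Multiset ℝ) : nodal (a ::ₘ T) = (X - C a) * nodal T := by
  simp [nodal]

lemma nodal_add (S T : Multiset ℝ) : nodal (S + T) = nodal S * nodal T := by simp [nodal]

lemma nodal_dvd_nodal {S T : Multiset ℝ} (h : S ≤ T) : nodal S ∣ nodal T := by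
  obtain ⟨U, rfl⟩ := Multiset.le_iff_exists_add.1 h
  exact ⟨nodal U, nodal_add S U⟩

lemma nodal_monic (T : Multiset ℝ) : (nodal T).Monic :=
  monic_multiset_prod_of_monic _ _ fun t _ => monic_X_sub_C t

lemma natDegree_nodal (T : Multiset ℝ) : (nodal T).natDegree = T.card :=
  natDegree_multiset_prod_X_sub_C_eq_card T

lemma degree_nodal (T : Multiset ℝ) : (nodal T).degree = T.card := by
  rw [degree_eq_natDegree (nodal_monic T).ne_zero, natDegree_nodal]

lemma coeff_nodal_card (T : Multiset ℝ) : (nodal T).coeff T.card = 1 := by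
  simpa [natDegree_nodal] using (nodal_monic T).coeff_natDegree

lemma degree_modByMonic_nodal_lt (T : Multiset ℝ) (g : ℝ[X]) : (g %ₘ nodal T).degree < T.card := by
  simpa [degree_nodal] using degree_modByMonic_lt g (nodal_monic T)

/-- The divided difference of the polynomial `g` at the nodes `T`, with multiplicities: the leading
coefficient of the Hermite interpolation polynomial of `g` at `T`. -/
noncomputable def divDiff (T : Multiset ℝ) : ℝ[X] →ₗ[ℝ] ℝ :=
  lcoeff ℝ (T.card - 1) ∘ₗ modByMonicHom (nodal T)

lemma divDiff_apply (T : Multiset ℝ) (g : ℝ[X]) :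
    divDiff T g = (g %ₘ nodal T).coeff (T.card - 1) := rfl

@[simp] lemma divDiff_zero (g : ℝ[X]) : divDiff 0 g = 0 := by
  simp [divDiff_apply, modByMonic_one]

lemma divDiff_eq_zero_of_dvd {T : Multiset ℝ} {g : ℝ[X]} (h : nodal T ∣ g) : divDiff T g = 0 := by
  rw [divDiff_apply, (modByMonic_eq_zero_iff_dvd (nodal_monic T)).2 h, coeff_zero]

lemma divDiff_congr {T : Multiset ℝ} {g h : ℝ[X]} (H : nodal T ∣ g - h) :
    divDiff T g = divDiff T h := by
  rw [← sub_eq_zero, ← map_sub, divDiff_eq_zero_of_dvd H]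

lemma divDiff_eq_coeff {T : Multiset ℝ} {g : ℝ[X]} (h : g.degree < T.card) :
    divDiff T g = g.coeff (T.card - 1) := by
  rw [divDiff_apply, (modByMonic_eq_self_iff (nodal_monic T)).2 (by rwa [degree_nodal])]

/-- Newton's form of the interpolant: removing the top term from the remainder at `b ::ₘ A` leaves a
polynomial of degree below `A.card` still congruent to `g` modulo `nodal A`. -/
lemma modByMonic_nodal_cons (b : ℝ) (A : Multiset ℝ) (g : ℝ[X]) :
    g %ₘ nodal (b ::ₘ A) = g %ₘ nodal A + C (divDiff (b ::ₘ A) g) * nodal A := by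
  set r := g %ₘ nodal (b ::ₘ A) with hr
  have hA := nodal_monic A
  have hdeg : r.degree < (A.card + 1 : ℕ) := by
    simpa only [Multiset.card_cons] using degree_modByMonic_nodal_lt (b ::ₘ A) g
  have hrest : (r - C (r.coeff A.card) * nodal A).degree < (nodal A).degree := by
    rw [degree_nodal, degree_lt_iff_coeff_zero]
    intro m hm
    rcases eq_or_lt_of_le hm with rfl | hm
    · simp [coeff_nodal_card]
    · have h1 : r.coeff m = 0 := (degree_lt_iff_coeff_zero _ _).1 hdeg m hm
      have h2 : (nodal A).coeff m = 0 :=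
        coeff_eq_zero_of_natDegree_lt (by rwa [natDegree_nodal])
      simp [h1, h2]
  have hg : g = nodal (b ::ₘ A) * (g /ₘ nodal (b ::ₘ A)) + r := by
    rw [hr, add_comm, modByMonic_add_div]
  have := (div_modByMonic_unique
    (f := g) (C (r.coeff A.card) + (X - C b) * (g /ₘ nodal (b ::ₘ A)))
    (r - C (r.coeff A.card) * nodal A) hA
    ⟨by conv_rhs => rw [hg]
        rw [nodal_cons]; ring, hrest⟩).2
  rw [this, divDiff_apply, ← hr]
  simp

/-- The interpolant at all the nodes has two Newton forms, with `a` or `b` added last; their top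
coefficients are compared. Without division, `a = b` is allowed. -/
lemma divDiff_exchange (a b : ℝ) (A : Multiset ℝ) (g : ℝ[X]) :
    (b - a) * divDiff (a ::ₘ b ::ₘ A) g = divDiff (b ::ₘ A) g - divDiff (a ::ₘ A) g := by
  have h1 := modByMonic_nodal_cons a (b ::ₘ A) g
  have h2 := modByMonic_nodal_cons b (a ::ₘ A) g
  rw [Multiset.cons_swap] at h2
  have h := h1.symm.trans h2
  rw [modByMonic_nodal_cons b A, modByMonic_nodal_cons a A, nodal_cons, nodal_cons] at h
  have h' : C (divDiff (b ::ₘ A) g - divDiff (a ::ₘ A) g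
      - (b - a) * divDiff (a ::ₘ b ::ₘ A) g) * nodal A = 0 := by
    simp only [C_sub, C_mul]
    linear_combination h
  have := congrArg (fun p => p.coeff A.card) h'
  simp only [coeff_C_mul, coeff_nodal_card, coeff_zero, mul_one] at this
  linarith

lemma divDiff_X_sub_C_mul_self (b : ℝ) (A : Multiset ℝ) (g : ℝ[X]) :
    divDiff (b ::ₘ A) ((X - C b) * g) = divDiff A g := by
  have hmod : ((X - C b) * g) %ₘ nodal (b ::ₘ A) = (X - C b) * (g %ₘ nodal A) := by
    refine (div_modByMonic_unique (g /ₘ nodal A) _ (nodal_monic _) ⟨?_, ?_⟩).2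
    · conv_rhs => rw [← modByMonic_add_div g (nodal A)]
      rw [nodal_cons]; ring
    · rw [nodal_cons, degree_mul, degree_mul, degree_X_sub_C]
      have := degree_modByMonic_lt g (nodal_monic A)
      exact WithBot.add_lt_add_left (by simp) this
  rw [divDiff_apply, hmod, divDiff_apply]
  have hc : (g %ₘ nodal A).coeff A.card = 0 :=
    (degree_lt_iff_coeff_zero _ _).1 (degree_modByMonic_nodal_lt A g) _ le_rfl
  rcases Nat.eq_zero_or_pos A.card with h0 | h0
  · obtain rfl := Multiset.card_eq_zero.1 h0
    simp [modByMonic_one]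
  · obtain ⟨n, hn⟩ := Nat.exists_eq_succ_of_ne_zero h0.ne'
    simp only [hn, Multiset.card_cons, Nat.succ_eq_add_one, Nat.add_sub_cancel] at hc ⊢
    rw [sub_mul, coeff_sub, coeff_X_mul, coeff_C_mul, hc]; ring

/-- The Leibniz rule for a linear factor, which is the source of the Cox-de Boor recursion. -/
lemma divDiff_X_sub_C_mul (b x : ℝ) (A : Multiset ℝ) (g : ℝ[X]) :
    divDiff (b ::ₘ A) ((X - C x) * g) = divDiff A g + (b - x) * divDiff (b ::ₘ A) g := by
  have : (X - C x) * g = (X - C b) * g + (b - x) • g := by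
    rw [smul_eq_C_mul, C_sub]; ring
  rw [this, map_add, map_smul, divDiff_X_sub_C_mul_self, smul_eq_mul]

lemma divDiff_C {T : Multiset ℝ} (h : 2 ≤ T.card) (r : ℝ) : divDiff T (C r) = 0 := by
  rw [divDiff_eq_coeff, coeff_C_of_ne_zero (by omega)]
  exact degree_C_le.trans_lt (by exact_mod_cast (by omega : 0 < T.card))

/-- Writing `g = (X - b) h + g(b)` removes the node `b` from every term on the left. Induction then
leaves `divDiff (b ::ₘ A) h + divDiff A h'`, which is the divided difference of `h + (X - b) h' =
g'`. This is degree raising in dual form. -/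
lemma sum_divDiff_cons_eq_divDiff_derivative (T : Multiset ℝ) (g : ℝ[X]) :
    (T.map fun t => divDiff (t ::ₘ T) g).sum = divDiff T (derivative g) := by
  induction T using Multiset.induction generalizing g with
  | empty => simp
  | cons b A ih =>
    obtain ⟨h, hh⟩ : ∃ h, g = (X - C b) * h + C (g.eval b) :=
      ⟨g /ₘ (X - C b), by
        rw [← modByMonic_X_sub_C_eq_C_eval, add_comm, modByMonic_add_div]⟩
    have h1 : ∀ t, divDiff (t ::ₘ b ::ₘ A) g = divDiff (t ::ₘ A) h := by
      intro t
      rw [hh, map_add, Multiset.cons_swap, divDiff_X_sub_C_mul_self, divDiff_C (by simp), add_zero]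
    simp only [h1, Multiset.map_cons, Multiset.sum_cons]
    rw [ih, hh]
    simp [divDiff_X_sub_C_mul, add_comm]

lemma divDiff_pair (a b : ℝ) (g : ℝ[X]) :
    (b - a) * divDiff {a, b} g = g.eval b - g.eval a := by
  have h : ∀ c : ℝ, divDiff {c} g = g.eval c := by
    intro c
    simp [divDiff_apply, nodal, modByMonic_X_sub_C_eq_C_eval]
  rw [← h, ← h]
  exact divDiff_exchange a b 0 g

/-! ### A polynomial substitute for a step function -/

lemma nodal_dvd_pow {S : Finset ℝ} {T : Multiset ℝ} (h : ∀ v ∈ T, v ∈ S) :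
    nodal T ∣ (∏ v ∈ S, (X - C v)) ^ T.card := by
  induction T using Multiset.induction with
  | empty => simp
  | cons a T ih =>
    rw [nodal_cons, Multiset.card_cons, pow_succ']
    exact mul_dvd_mul (Finset.dvd_prod_of_mem _ (h a (by simp)))
      (ih fun v hv => h v (by simp [hv]))

/-- `e` plays the role of the indicator function of `(c, ∞)` on the grid `G`: its Taylor expansions
of order `M` at the grid points are those of that function. -/
structure IsCut (G : Finset ℝ) (c : ℝ) (M : ℕ) (e : ℝ[X]) : Prop where
  left : ∀ T : Multiset ℝ, T.card ≤ M → (∀ v ∈ T, v ∈ G ∧ v ≤ c) → nodal T ∣ e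
  right : ∀ T : Multiset ℝ, T.card ≤ M → (∀ v ∈ T, v ∈ G ∧ c < v) → nodal T ∣ e - 1
  deriv : ∀ (d : ℕ) (f : ℝ[X]) (T : Multiset ℝ), T.card + d ≤ M → (∀ v ∈ T, v ∈ G) →
    nodal T ∣ derivative^[d] (e * f) - e * derivative^[d] f

lemma pow_dvd_derivative {p u : ℝ[X]} {n : ℕ} (h : p ^ (n + 1) ∣ u) : p ^ n ∣ derivative u := by
  obtain ⟨v, rfl⟩ := h
  rw [derivative_mul, derivative_pow_succ, pow_succ]
  exact dvd_add (((dvd_mul_left _ _).mul_right _).mul_right _)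
    (((dvd_mul_right _ _).mul_right _))

/-- Bézout: with `a L^(M+1) + b R^(M+1) = 1`, the polynomial `e = a L^(M+1)` vanishes to high order
at the points up to `c`, and `1 - e` does so beyond `c`. Hence `e'` vanishes to high order on the
whole grid, and multiplication by `e` commutes with differentiation up to small error. -/
lemma exists_isCut (G : Finset ℝ) (c : ℝ) (M : ℕ) : ∃ e, IsCut G c M e := by
  set L : ℝ[X] := ∏ v ∈ G with v ≤ c, (X - C v) with hL
  set R : ℝ[X] := ∏ v ∈ G with c < v, (X - C v) with hR
  have hLR : IsCoprime L R := by
    refine IsCoprime.prod_left fun v hv => IsCoprime.prod_right fun w hw => ?_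
    refine isCoprime_X_sub_C_of_isUnit_sub ?_
    simp only [Finset.mem_filter] at hv hw
    exact (sub_ne_zero.2 (hv.2.trans_lt hw.2).ne).isUnit
  have hV : ∏ v ∈ G, (X - C v) = L * R := by
    rw [hL, hR, ← Finset.prod_filter_mul_prod_filter_not G (fun v => v ≤ c)]
    simp only [not_le]
  obtain ⟨a, b, hab⟩ := (hLR.pow : IsCoprime (L ^ (M + 1)) (R ^ (M + 1)))
  have hde : (L * R) ^ M ∣ derivative (a * L ^ (M + 1)) := by
    rw [mul_pow]
    refine (hLR.pow : IsCoprime (L ^ M) (R ^ M)).mul_dvd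
      (pow_dvd_derivative (dvd_mul_left _ _)) ?_
    have h1 : a * L ^ (M + 1) = 1 - b * R ^ (M + 1) := by rw [← hab]; ring
    rw [h1, derivative_sub, derivative_one, zero_sub, dvd_neg]
    exact pow_dvd_derivative (dvd_mul_left _ _)
  have hder : ∀ (d : ℕ) (f : ℝ[X]), d ≤ M → (L * R) ^ (M - d) ∣
      derivative^[d] (a * L ^ (M + 1) * f) - a * L ^ (M + 1) * derivative^[d] f := by
    intro d f hd
    induction d with
    | zero => simp
    | succ d ih =>
      have h1 := ih (by omega)
      rw [show M - d = (M - (d + 1)) + 1 by omega] at h1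
      have h2 := pow_dvd_derivative h1
      have h3 : (L * R) ^ (M - (d + 1)) ∣ derivative (a * L ^ (M + 1)) * derivative^[d] f :=
        ((pow_dvd_pow _ (by omega)).trans hde).mul_right _
      have h4 := dvd_add h2 h3
      rw [derivative_sub, derivative_mul (f := a * L ^ (M + 1))] at h4
      rw [Function.iterate_succ_apply', Function.iterate_succ_apply']
      convert h4 using 1
      ring
  refine ⟨a * L ^ (M + 1), ?_, ?_, ?_⟩
  · intro T hT h
    refine Dvd.dvd.mul_left ((nodal_dvd_pow (S := G.filter (· ≤ c)) fun v hv => ?_).trans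
      (pow_dvd_pow _ (by omega))) _
    simpa using h v hv
  · intro T hT h
    have h1 : a * L ^ (M + 1) - 1 = -(b * R ^ (M + 1)) := by rw [← hab]; ring
    rw [h1, dvd_neg]
    refine Dvd.dvd.mul_left ((nodal_dvd_pow (S := G.filter (c < ·)) fun v hv => ?_).trans
      (pow_dvd_pow _ (by omega))) _
    simpa using h v hv
  · intro d f T hT h
    refine ((nodal_dvd_pow h).trans ?_).trans (hder d f (by omega))
    rw [hV]
    exact pow_dvd_pow _ (by omega)

section
variable {G : Finset ℝ} {c : ℝ} {M : ℕ} {e : ℝ[X]}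

lemma IsCut.divDiff_left (he : IsCut G c M e) {T : Multiset ℝ} (hT : T.card ≤ M)
    (h : ∀ v ∈ T, v ∈ G ∧ v ≤ c) (f : ℝ[X]) : divDiff T (e * f) = 0 :=
  divDiff_eq_zero_of_dvd ((he.left T hT h).mul_right f)

lemma IsCut.divDiff_right (he : IsCut G c M e) {T : Multiset ℝ} (hT : T.card ≤ M)
    (h : ∀ v ∈ T, v ∈ G ∧ c < v) {f : ℝ[X]} (hf : f.degree < T.card) :
    divDiff T (e * f) = f.coeff (T.card - 1) := by
  rw [← divDiff_eq_coeff hf]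
  refine divDiff_congr ?_
  rw [show e * f - f = (e - 1) * f by ring]
  exact (he.right T hT h).mul_right f

end

/-! ### B-splines as divided differences -/

/-- The multiset of the knots `t i`, `i ∈ S`. -/
def nodes (t : ℕ → ℝ) (S : Finset ℕ) : Multiset ℝ := S.val.map t

@[simp] lemma card_nodes (t : ℕ → ℝ) (S : Finset ℕ) : (nodes t S).card = S.card := by
  simp [nodes]

lemma mem_nodes {t : ℕ → ℝ} {S : Finset ℕ} {v : ℝ} : v ∈ nodes t S ↔ ∃ i ∈ S, t i = v := by
  simp [nodes]

lemma nodes_insert (t : ℕ → ℝ) {S : Finset ℕ} {i : ℕ} (h : i ∉ S) :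
    nodes t (insert i S) = t i ::ₘ nodes t S := by
  simp [nodes, Finset.insert_val_of_notMem h]

lemma nodes_Ico_left (t : ℕ → ℝ) {i j : ℕ} (h : i < j) :
    nodes t (Finset.Ico i j) = t i ::ₘ nodes t (Finset.Ico (i + 1) j) := by
  rw [← nodes_insert t (by simp)]
  congr 1
  ext l; simp; omega

lemma nodes_Ico_right (t : ℕ → ℝ) {i j : ℕ} (h : i ≤ j) :
    nodes t (Finset.Ico i (j + 1)) = t j ::ₘ nodes t (Finset.Ico i j) := by
  rw [← nodes_insert t (by simp)]
  congr 1
  ext l; simp; omega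

/-- The span of `x` among the knots `t` starts at `c`. -/
def IsSpan (t : ℕ → ℝ) (x c : ℝ) : Prop :=
  ∀ i, ((t i ≤ x ∧ x < t (i + 1)) ∨ (t i < 1 ∧ t (i + 1) = 1 ∧ x = 1)) ↔ (t i ≤ c ∧ c < t (i + 1))

section
variable {t : ℕ → ℝ} {G : Finset ℝ} {c x : ℝ} {M : ℕ} {e : ℝ[X]}

/-- Coinciding knots lie on one side of `c`, where `e` acts as 0 or 1, and `q + 2` nodes annihilate
degree `q`. This justifies counting quotients with denominator zero as zero in the recursion. -/
lemma IsCut.divDiff_nodes_eq_zero (he : IsCut G c M e) (hmono : Monotone t) (hG : ∀ i, t i ∈ G)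
    {q i : ℕ} (hq : q + 2 ≤ M) (h : t i = t (i + q + 1)) :
    divDiff (nodes t (Finset.Ico i (i + q + 2))) (e * (X - C x) ^ q) = 0 := by
  have hv : ∀ v ∈ nodes t (Finset.Ico i (i + q + 2)), v ∈ G ∧ v = t i := by
    intro v hv
    obtain ⟨l, hl, rfl⟩ := mem_nodes.1 hv
    rw [Finset.mem_Ico] at hl
    exact ⟨hG l, le_antisymm (h ▸ hmono (by omega)) (hmono hl.1)⟩
  have hcard : (nodes t (Finset.Ico i (i + q + 2))).card = q + 2 := by simp; omega
  rcases le_or_gt (t i) c with hc | hc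
  · exact he.divDiff_left (by omega) (fun v h => ⟨(hv v h).1, (hv v h).2 ▸ hc⟩) _
  · have hd : ((X - C x) ^ q).natDegree = q := by simp
    rw [he.divDiff_right (by omega) (fun v h => ⟨(hv v h).1, (hv v h).2 ▸ hc⟩), hcard]
    · exact coeff_eq_zero_of_natDegree_lt (by omega)
    · rw [hcard]
      exact degree_le_natDegree.trans_lt (by rw [hd]; exact_mod_cast (by omega : q < q + 2))

/-- A B-spline is a scaled divided difference of the truncated power function. -/
lemma coxDeBoor_eq_divDiff (he : IsCut G c M e) (hmono : Monotone t) (hG : ∀ i, t i ∈ G)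
    (hx : IsSpan t x c) (q i : ℕ) (hq : q + 2 ≤ M) :
    coxDeBoor t q i x = (t (i + q + 1) - t i) *
      divDiff (nodes t (Finset.Ico i (i + q + 2))) (e * (X - C x) ^ q) := by
  induction q generalizing i with
  | zero =>
    have heval : ∀ j, e.eval (t j) = if c < t j then 1 else 0 := by
      intro j
      split_ifs with h
      · have := he.right {t j} (by simp; omega) (by simp [hG, h])
        rw [nodal, Multiset.map_singleton, Multiset.prod_singleton, dvd_iff_isRoot] at this
        simpa [sub_eq_zero] using this
      · have := he.left {t j} (by simp; omega) (by simp [hG, not_lt.1 h])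
        rw [nodal, Multiset.map_singleton, Multiset.prod_singleton, dvd_iff_isRoot] at this
        simpa using this
    have hn : nodes t (Finset.Ico i (i + 0 + 2)) = {t i, t (i + 1)} := by
      rw [nodes_Ico_left t (by omega), nodes_Ico_left t (by omega)]
      simp [nodes]
    rw [hn, coxDeBoor, add_zero, divDiff_pair, pow_zero, mul_one, heval, heval]
    have h1 := hx i
    have h2 := hmono (Nat.le_succ i)
    by_cases h3 : t i ≤ c ∧ c < t (i + 1)
    · rw [if_pos (h1.2 h3), if_pos h3.2, if_neg (not_lt.2 h3.1)]; simp
    · rw [if_neg (fun h => h3 (h1.1 h))]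
      by_cases h4 : c < t i
      · rw [if_pos h4, if_pos (h4.trans_le h2)]; simp
      · rw [if_neg h4, if_neg (fun h => h3 ⟨not_lt.1 h4, h⟩)]; simp
  | succ q ih =>
    rw [coxDeBoor, ih i (by omega), ih (i + 1) (by omega)]
    have e1 : i + 1 + q + 1 = i + q + 2 := by omega
    have e2 : i + 1 + q + 2 = i + q + 2 + 1 := by omega
    have e3 : i + (q + 1) + 2 = i + q + 2 + 1 := by omega
    have e4 : i + (q + 1) + 1 = i + q + 2 := by omega
    rw [e1, e2, e3, e4]
    -- The scaling factor cancels the denominator of the recursion; if it is zero, the divided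
    -- difference is zero as well.
    have c1 : ∀ {d y z : ℝ}, (d = 0 → z = 0) → y / d * (d * z) = y * z := by
      intro d y z h
      by_cases hd : d = 0
      · rw [h hd]; simp
      · field_simp
    rw [c1 fun h => he.divDiff_nodes_eq_zero hmono hG (by omega) (sub_eq_zero.1 h).symm,
      c1 fun h => ?_]
    · rw [nodes_Ico_left t (by omega : i < i + q + 2 + 1),
        nodes_Ico_left t (by omega : i < i + q + 2),
        nodes_Ico_right t (by omega : i + 1 ≤ i + q + 2)]
      set A := nodes t (Finset.Ico (i + 1) (i + q + 2))
      -- The Leibniz rule at the last knot absorbs the additional factor `X - x`; the exchange rule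
      -- then yields the two B-splines of lower degree.
      rw [Multiset.cons_swap, pow_succ', show e * ((X - C x) * (X - C x) ^ q)
        = (X - C x) * (e * (X - C x) ^ q) by ring, divDiff_X_sub_C_mul, Multiset.cons_swap]
      have := divDiff_exchange (t i) (t (i + q + 2)) A (e * (X - C x) ^ q)
      linear_combination (-(t (i + q + 2) - x)) * this
    · have := he.divDiff_nodes_eq_zero (x := x) (q := q) (i := i + 1) hmono hG (by omega)
      rw [e1, e2] at this
      exact this (sub_eq_zero.1 h).symm

/-- Each B-spline is a difference of consecutive divided differences at `q + 1` knots, so the sum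
telescopes. The first one has all its nodes up to `c` and vanishes; the last has all of them beyond
`c` and is the leading coefficient of `(X - x) ^ q`. -/
lemma sum_coxDeBoor_eq_one (he : IsCut G c M e) (hmono : Monotone t) (hG : ∀ i, t i ∈ G)
    (hx : IsSpan t x c) {q n : ℕ} (hq : q + 2 ≤ M) (hl : t q ≤ c) (hr : c < t n) :
    ∑ i ∈ Finset.range n, coxDeBoor t q i x = 1 := by
  have htel : ∀ i, coxDeBoor t q i x =
      divDiff (nodes t (Finset.Ico (i + 1) (i + 1 + q + 1))) (e * (X - C x) ^ q)
        - divDiff (nodes t (Finset.Ico i (i + q + 1))) (e * (X - C x) ^ q) := by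
    intro i
    rw [coxDeBoor_eq_divDiff he hmono hG hx q i hq,
      show i + 1 + q + 1 = i + q + 1 + 1 by omega,
      nodes_Ico_left t (by omega : i < i + q + 2),
      nodes_Ico_left t (by omega : i < i + q + 1),
      show i + q + 2 = i + q + 1 + 1 by omega,
      nodes_Ico_right t (by omega : i + 1 ≤ i + q + 1), divDiff_exchange]
  simp only [htel]
  rw [Finset.sum_range_sub (fun i => divDiff (nodes t (Finset.Ico i (i + q + 1)))
    (e * (X - C x) ^ q))]
  have hd : ((X - C x) ^ q).natDegree = q := by simp
  have hmon : ((X - C x) ^ q).Monic := (monic_X_sub_C x).pow q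
  rw [he.divDiff_right, he.divDiff_left, sub_zero]
  · have := hmon.coeff_natDegree
    rw [hd] at this
    rwa [card_nodes, Nat.card_Ico, show n + q + 1 - n - 1 = q by omega]
  · simp; omega
  · intro v hv
    obtain ⟨l, hl', rfl⟩ := mem_nodes.1 hv
    rw [Finset.mem_Ico] at hl'
    exact ⟨hG l, (hmono (by omega)).trans hl⟩
  · simp; omega
  · intro v hv
    obtain ⟨l, hl', rfl⟩ := mem_nodes.1 hv
    rw [Finset.mem_Ico] at hl'
    exact ⟨hG l, hr.trans_le (hmono hl'.1)⟩
  · refine degree_le_natDegree.trans_lt ?_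
    rw [hd, card_nodes, Nat.card_Ico]
    exact_mod_cast (by omega)

lemma coxDeBoor_eq_zero (hmono : Monotone t) (q i : ℕ) (h : x ∉ Set.Icc (t i) (t (i + q + 1))) :
    coxDeBoor t q i x = 0 := by
  induction q generalizing i with
  | zero =>
    rw [coxDeBoor, if_neg]
    rintro (h1 | h1)
    · exact h ⟨h1.1, h1.2.le⟩
    · exact h ⟨h1.2.2 ▸ h1.1.le, by rw [h1.2.2]; exact h1.2.1.ge⟩
  | succ q ih =>
    rw [coxDeBoor, ih i fun h' => h ⟨h'.1, h'.2.trans (hmono (by omega))⟩,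
      ih (i + 1) fun h' => h ⟨(hmono (by omega)).trans h'.1, h'.2.trans (hmono (by omega))⟩]
    simp

lemma coxDeBoor_nonneg (hmono : Monotone t) (q i : ℕ) (x : ℝ) : 0 ≤ coxDeBoor t q i x := by
  induction q generalizing i with
  | zero => rw [coxDeBoor]; split_ifs <;> simp
  | succ q ih =>
    by_cases h : x ∈ Set.Icc (t i) (t (i + q + 2))
    · rw [coxDeBoor]
      have h1 := hmono (by omega : i ≤ i + q + 1)
      have h2 := hmono (by omega : i + 1 ≤ i + q + 2)
      exact add_nonneg
        (mul_nonneg (div_nonneg (sub_nonneg.2 h.1) (sub_nonneg.2 h1)) (ih i))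
        (mul_nonneg (div_nonneg (sub_nonneg.2 h.2) (sub_nonneg.2 h2)) (ih (i + 1)))
    · exact (coxDeBoor_eq_zero hmono (q + 1) i h).ge

end

/-! ### Knot insertion and degree raising with nonnegative coefficients -/

open NNReal

/-- The cone spanned by the divided differences at `q + 2` consecutive knots with indices in
`[a, b)`. -/
noncomputable def windowCone (t : ℕ → ℝ) (q a b : ℕ) : Submodule ℝ≥0 (ℝ[X] →ₗ[ℝ] ℝ) :=
  Submodule.span ℝ≥0
    ((fun j => divDiff (nodes t (Finset.Ico j (j + q + 2)))) '' {j | a ≤ j ∧ j + q + 2 ≤ b})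

section
variable {t : ℕ → ℝ}

lemma smul_mem_cone {P : Submodule ℝ≥0 (ℝ[X] →ₗ[ℝ] ℝ)} {r : ℝ} (hr : 0 ≤ r)
    {f : ℝ[X] →ₗ[ℝ] ℝ} (hf : f ∈ P) : r • f ∈ P :=
  P.smul_mem ⟨r, hr⟩ hf

lemma windowCone_mono {q a b a' b' : ℕ} (ha : a' ≤ a) (hb : b ≤ b') :
    windowCone t q a b ≤ windowCone t q a' b' :=
  Submodule.span_mono (Set.image_mono fun _ hj => ⟨ha.trans hj.1, hj.2.trans hb⟩)

lemma divDiff_window_mem {q a b j : ℕ} (ha : a ≤ j) (hb : j + q + 2 ≤ b) :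
    divDiff (nodes t (Finset.Ico j (j + q + 2))) ∈ windowCone t q a b :=
  Submodule.subset_span ⟨j, ⟨ha, hb⟩, rfl⟩

/-- Knot insertion. -/
lemma divDiff_nodes_mem_windowCone (hmono : Monotone t) (q : ℕ) (n : ℕ) :
    ∀ (S : Finset ℕ) (a : ℕ), S ⊆ Finset.Ico a (a + n) → S.card = q + 2 →
      divDiff (nodes t S) ∈ windowCone t q a (a + n) := by
  induction n with
  | zero => intro S a hS hc; simp at hS; simp [hS] at hc
  | succ n ih =>
    intro S a hS hc
    -- If an end of the index interval is not in `S`, the interval shrinks. Otherwise either `S` is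
    -- a full window or some inner index `z` is missing.
    by_cases ha : a ∈ S
    swap
    · refine windowCone_mono (Nat.le_succ a) (by omega) (ih S (a + 1) (fun l hl => ?_) hc)
      have := Finset.mem_Ico.1 (hS hl)
      have : l ≠ a := fun h => ha (h ▸ hl)
      rw [Finset.mem_Ico]; omega
    by_cases hb : a + n ∈ S
    swap
    · refine windowCone_mono le_rfl (by omega) (ih S a (fun l hl => ?_) hc)
      have := Finset.mem_Ico.1 (hS hl)
      have : l ≠ a + n := fun h => hb (h ▸ hl)
      rw [Finset.mem_Ico]; omega
    by_cases hw : ∃ z ∈ Finset.Ico a (a + (n + 1)), z ∉ S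
    swap
    · push Not at hw
      have hSe : S = Finset.Ico a (a + (n + 1)) := Finset.Subset.antisymm hS hw
      have hn : n + 1 = q + 2 := by rw [← hc, hSe]; simp
      rw [hSe, hn]
      exact divDiff_window_mem le_rfl le_rfl
    obtain ⟨z, hz, hzS⟩ := hw
    rw [Finset.mem_Ico] at hz
    have hza : z ≠ a := fun h => hzS (h ▸ ha)
    have hzb : z ≠ a + n := fun h => hzS (h ▸ hb)
    -- If the extreme knots coincide, every choice of `q + 2` indices gives the same multiset of
    -- nodes.
    rcases eq_or_lt_of_le (hmono (by omega : a ≤ a + n)) with heq | hlt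
    · have hconst : ∀ U ⊆ Finset.Ico a (a + (n + 1)), U.card = q + 2 →
          nodes t U = Multiset.replicate (q + 2) (t a) := by
        intro U hU hUc
        rw [Multiset.eq_replicate]
        refine ⟨by simp [hUc], fun v hv => ?_⟩
        obtain ⟨l, hl, rfl⟩ := mem_nodes.1 hv
        have := Finset.mem_Ico.1 (hU hl)
        exact le_antisymm (heq ▸ hmono (by omega)) (hmono this.1)
      have hle : q + 2 ≤ n + 1 := by
        have := Finset.card_le_card hS
        rw [hc] at this; simpa using this
      rw [hconst S hS hc, ← hconst (Finset.Ico a (a + q + 2))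
        (Finset.Ico_subset_Ico_right (by omega)) (by simp; omega)]
      exact divDiff_window_mem le_rfl (by omega)
    -- Replacing either extreme index by `z` gives two sets in shorter intervals. Since `t z` lies
    -- between the extreme knots, `key` is a convex combination.
    · set A := (S.erase a).erase (a + n) with hA
      have hbA : a + n ∈ S.erase a := Finset.mem_erase.2 ⟨by omega, hb⟩
      have hS1 : S = insert a (insert (a + n) A) := by
        rw [hA, Finset.insert_erase hbA, Finset.insert_erase ha]
      have hAmem : ∀ l ∈ A, a < l ∧ l < a + n := by
        intro l hl
        simp only [hA, Finset.mem_erase] at hl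
        have := Finset.mem_Ico.1 (hS hl.2.2)
        omega
      have haA : a ∉ insert (a + n) A := by
        simp only [Finset.mem_insert, not_or]
        exact ⟨by omega, fun h => by have := hAmem a h; omega⟩
      have hbA' : a + n ∉ A := fun h => by have := hAmem _ h; omega
      have hzA : z ∉ A := fun h => hzS (by rw [hS1]; simp [h])
      have haz : a ∉ insert z A := by
        simp only [Finset.mem_insert, not_or]
        exact ⟨by omega, fun h => by have := hAmem a h; omega⟩
      have hbz : a + n ∉ insert z A := by
        simp only [Finset.mem_insert, not_or]
        exact ⟨by omega, hbA'⟩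
      have hAc : A.card + 2 = q + 2 := by
        rw [← hc, hS1, Finset.card_insert_of_notMem haA, Finset.card_insert_of_notMem hbA']
      have m1 : divDiff (nodes t (insert a (insert z A))) ∈ windowCone t q a (a + (n + 1)) := by
        refine windowCone_mono le_rfl (by omega) (ih _ a (fun l hl => ?_) ?_)
        · simp only [Finset.mem_insert] at hl
          rw [Finset.mem_Ico]
          rcases hl with rfl | rfl | hl
          · omega
          · omega
          · have := hAmem l hl; omega
        · rw [Finset.card_insert_of_notMem haz, Finset.card_insert_of_notMem hzA, hAc]
      have m2 : divDiff (nodes t (insert (a + n) (insert z A)))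
          ∈ windowCone t q a (a + (n + 1)) := by
        refine windowCone_mono (Nat.le_succ a) (by omega) (ih _ (a + 1) (fun l hl => ?_) ?_)
        · simp only [Finset.mem_insert] at hl
          rw [Finset.mem_Ico]
          rcases hl with rfl | rfl | hl
          · omega
          · omega
          · have := hAmem l hl; omega
        · rw [Finset.card_insert_of_notMem hbz, Finset.card_insert_of_notMem hzA, hAc]
      have hd : 0 < t (a + n) - t a := sub_pos.2 hlt
      have key : divDiff (nodes t S) =
          ((t z - t a) / (t (a + n) - t a)) • divDiff (nodes t (insert a (insert z A)))
          + ((t (a + n) - t z) / (t (a + n) - t a)) •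
              divDiff (nodes t (insert (a + n) (insert z A))) := by
        refine LinearMap.ext fun g => ?_
        rw [hS1, LinearMap.add_apply, LinearMap.smul_apply, LinearMap.smul_apply,
          nodes_insert t haA, nodes_insert t hbA', nodes_insert t haz, nodes_insert t hbz,
          nodes_insert t hzA, smul_eq_mul, smul_eq_mul]
        have h1 := divDiff_exchange (t a) (t (a + n)) (t z ::ₘ nodes t A) g
        have h2 := divDiff_exchange (t z) (t (a + n)) (t a ::ₘ nodes t A) g
        have hp : t z ::ₘ t (a + n) ::ₘ t a ::ₘ nodes t A
            = t a ::ₘ t (a + n) ::ₘ t z ::ₘ nodes t A := by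
          rw [Multiset.cons_swap (t (a + n)) (t a), Multiset.cons_swap (t z) (t a),
            Multiset.cons_swap (t z) (t (a + n))]
        rw [hp, Multiset.cons_swap (t z) (t a), Multiset.cons_swap (t (a + n)) (t a)] at h2
        field_simp
        linear_combination (t (a + n) - t z) * h1 - (t (a + n) - t a) * h2
      rw [key]
      exact add_mem
        (smul_mem_cone (div_nonneg (sub_nonneg.2 (hmono (by omega))) hd.le) m1)
        (smul_mem_cone (div_nonneg (sub_nonneg.2 (hmono (by omega))) hd.le) m2)

lemma exists_nodes_eq_of_le {K : Finset ℕ} {T : Multiset ℝ} (h : T ≤ nodes t K) :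
    ∃ S ⊆ K, nodes t S = T := by
  induction K using Finset.induction generalizing T with
  | empty => exact ⟨∅, by simp, (Multiset.le_zero.1 (by simpa [nodes] using h)).symm ▸ by simp [nodes]⟩
  | insert a K ha ih =>
    rw [nodes_insert t ha] at h
    by_cases hT : t a ∈ T
    · obtain ⟨U, rfl⟩ := Multiset.exists_cons_of_mem hT
      obtain ⟨S, hS, rfl⟩ := ih ((Multiset.cons_le_cons_iff _).1 h)
      exact ⟨insert a S, Finset.insert_subset_insert a hS, nodes_insert t fun h => ha (hS h)⟩
    · obtain ⟨S, hS, rfl⟩ := ih ((Multiset.le_cons_of_notMem hT).1 h)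
      exact ⟨S, hS.trans (Finset.subset_insert a K), rfl⟩

/-- Degree raising followed by knot insertion. -/
lemma divDiff_iterate_derivative_mem_windowCone (hmono : Monotone t) (q a b d : ℕ) :
    ∀ T : Multiset ℝ, T.card + d = q + 2 →
      (∀ z ∈ T, T.count z + d ≤ (nodes t (Finset.Ico a b)).count z) →
      divDiff T ∘ₗ derivative ^ d ∈ windowCone t q a b := by
  induction d with
  | zero =>
    intro T hc h
    have hle : T ≤ nodes t (Finset.Ico a b) := by
      rw [Multiset.le_iff_count]
      intro z
      by_cases hz : z ∈ T
      · exact h z hz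
      · simp [Multiset.count_eq_zero_of_notMem hz]
    obtain ⟨S, hS, rfl⟩ := exists_nodes_eq_of_le hle
    rw [card_nodes] at hc
    have hab : a ≤ b := by
      by_contra hab
      rw [Finset.Ico_eq_empty (by omega), Finset.subset_empty] at hS
      simp [hS] at hc
    obtain ⟨n, rfl⟩ := Nat.exists_eq_add_of_le hab
    rw [pow_zero, Module.End.one_eq_id, LinearMap.comp_id]
    exact divDiff_nodes_mem_windowCone hmono q n S a hS hc
  | succ d ih =>
    intro T hc h
    -- Each derivative is traded for one more copy of a node already present, so a multiplicity
    -- grows by at most one; the count hypothesis reserves room for all of these copies.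
    have key : divDiff T ∘ₗ derivative ^ (d + 1)
        = (T.map fun z => divDiff (z ::ₘ T) ∘ₗ derivative ^ d).sum := by
      refine LinearMap.ext fun g => ?_
      have h1 := sum_divDiff_cons_eq_divDiff_derivative T ((derivative ^ d : ℝ[X] →ₗ[ℝ] ℝ[X]) g)
      rw [pow_succ', LinearMap.comp_apply, Module.End.mul_apply, ← h1]
      have : ∀ U : Multiset ℝ, (U.map fun z => divDiff (z ::ₘ T) ∘ₗ derivative ^ d).sum g
          = (U.map fun z => divDiff (z ::ₘ T) ((derivative ^ d : ℝ[X] →ₗ[ℝ] ℝ[X]) g)).sum := by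
        intro U
        induction U using Multiset.induction with
        | empty => simp
        | cons u U ih => simp [ih]
      exact (this T).symm
    rw [key]
    refine multiset_sum_mem _ fun f hf => ?_
    obtain ⟨z, hz, rfl⟩ := Multiset.mem_map.1 hf
    refine ih _ (by simp; omega) fun y hy => ?_
    have hyT : y ∈ T := by
      rcases Multiset.mem_cons.1 hy with rfl | hy
      · exact hz
      · exact hy
    have := h y hyT
    have h2 : (z ::ₘ T).count y ≤ T.count y + 1 := by
      rw [Multiset.count_cons]; split_ifs <;> omega
    omega

/-- One coefficient sequence must serve all `g`, since it is later applied to truncated powers with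
varying `x`. The bound on `n` ensures that the sum covers every window inside `[a, b)`. -/
lemma exists_coeff_of_mem_windowCone {q a b : ℕ} {f : ℝ[X] →ₗ[ℝ] ℝ}
    (h : f ∈ windowCone t q a b) :
    ∃ α : ℕ → ℝ, (∀ j, 0 ≤ α j) ∧ (∀ j, α j ≠ 0 → a ≤ j ∧ j + q + 2 ≤ b) ∧
      ∀ n, b ≤ n + q + 1 → ∀ g, f g =
        ∑ j ∈ Finset.range n, α j * divDiff (nodes t (Finset.Ico j (j + q + 2))) g := by
  induction h using Submodule.span_induction with
  | mem f hf =>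
    obtain ⟨j, hj, rfl⟩ := hf
    refine ⟨fun i => if i = j then 1 else 0, fun i => by dsimp; split_ifs <;> simp, ?_, ?_⟩
    · intro i hi
      have : i = j := by by_contra h; simp [h] at hi
      exact this ▸ hj
    · intro n hn g
      have := hj.2
      simp [Finset.sum_ite_eq', show j < n by omega]
  | zero => exact ⟨0, by simp, by simp, by simp⟩
  | add f g _ _ hf hg =>
    obtain ⟨α, h1, h2, h3⟩ := hf
    obtain ⟨β, h4, h5, h6⟩ := hg
    refine ⟨fun j => α j + β j, fun j => add_nonneg (h1 j) (h4 j), fun j hj => ?_, ?_⟩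
    · by_cases hα : α j = 0
      · exact h5 j (by simpa [hα] using hj)
      · exact h2 j hα
    · intro n hn g
      rw [LinearMap.add_apply, h3 n hn, h6 n hn, ← Finset.sum_add_distrib]
      exact Finset.sum_congr rfl fun j _ => by ring
  | smul r f _ hf =>
    obtain ⟨α, h1, h2, h3⟩ := hf
    refine ⟨fun j => r * α j, fun j => mul_nonneg r.2 (h1 j), fun j hj => ?_, ?_⟩
    · exact h2 j (right_ne_zero_of_mul hj)
    · intro n hn g
      rw [LinearMap.smul_apply, h3 n hn, NNReal.smul_def, smul_eq_mul, Finset.mul_sum]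
      exact Finset.sum_congr rfl fun j _ => by ring

end

/-! ### Nonnegative expansions and local linear independence -/

section
variable {t τ : ℕ → ℝ} {G : Finset ℝ}

/-- At the nodes `e` behaves like a locally constant function, so the derivatives fall on the power
alone and lower its degree from `p + d` to `p`. -/
lemma IsCut.divDiff_iterate_derivative {c : ℝ} {M : ℕ} {e : ℝ[X]} (he : IsCut G c M e)
    {T : Multiset ℝ} {p d : ℕ} (hT : T.card + d ≤ M) (hG : ∀ v ∈ T, v ∈ G) (x : ℝ) :
    divDiff T (derivative^[d] (e * (X - C x) ^ (p + d)))
      = (p + d).descFactorial d * divDiff T (e * (X - C x) ^ p) := by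
  rw [divDiff_congr (he.deriv d _ T hT hG), iterate_derivative_X_sub_pow, Nat.add_sub_cancel,
    mul_smul_comm, map_nsmul, nsmul_eq_mul]

/-- A B-spline of lower degree is a nonnegative combination of the B-splines of higher degree over a
knot sequence that contains enough copies of its knots. -/
lemma exists_nonneg_expansion (hmono : Monotone t) (hG : ∀ i, t i ∈ G)
    (hmono' : Monotone τ) (hG' : ∀ i, τ i ∈ G) {p q a b n i : ℕ} (hpq : p ≤ q)
    (hn : b ≤ n + q + 1) (ht : ∀ j < n, t j < t (j + q + 1))
    (hcount : ∀ z ∈ nodes τ (Finset.Ico i (i + p + 2)),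
      (nodes τ (Finset.Ico i (i + p + 2))).count z + (q - p)
        ≤ (nodes t (Finset.Ico a b)).count z) :
    ∃ m : ℕ → ℝ, (∀ j, 0 ≤ m j) ∧ (∀ j, m j ≠ 0 → a ≤ j ∧ j + q + 2 ≤ b) ∧
      ∀ x c, IsSpan t x c → IsSpan τ x c →
        coxDeBoor τ p i x = ∑ j ∈ Finset.range n, m j * coxDeBoor t q j x := by
  obtain ⟨d, rfl⟩ := Nat.exists_eq_add_of_le hpq
  rw [Nat.add_sub_cancel_left] at hcount
  set T := nodes τ (Finset.Ico i (i + p + 2)) with hT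
  have hTc : T.card = p + 2 := by simp [hT]; omega
  obtain ⟨α, hα, hsupp, hsum⟩ := exists_coeff_of_mem_windowCone
    (divDiff_iterate_derivative_mem_windowCone hmono (p + d) a b d T (by omega) hcount)
  have hD : (0 : ℝ) < (p + d).descFactorial d := by
    exact_mod_cast Nat.descFactorial_pos.2 (by omega)
  have hτ : 0 ≤ τ (i + p + 1) - τ i := sub_nonneg.2 (hmono' (by omega))
  -- The factors are the scaling of the B-spline over `τ`, the inverse scaling of those over `t`
  -- (nonzero by `ht`), and the constant from differentiating the power `d` times.
  refine ⟨fun j => (τ (i + p + 1) - τ i) * (α j / ((t (j + (p + d) + 1) - t j) *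
    (p + d).descFactorial d)), fun j => ?_, fun j hj => ?_, fun x c hx hx' => ?_⟩
  · exact mul_nonneg hτ (div_nonneg (hα j)
      (mul_nonneg (sub_nonneg.2 (hmono (by omega))) hD.le))
  · exact hsupp j fun h => hj (by simp [h])
  · obtain ⟨e, he⟩ := exists_isCut G c (p + d + 2)
    rw [coxDeBoor_eq_divDiff he hmono' hG' hx' p i (by omega)]
    have h1 := hsum n hn (e * (X - C x) ^ (p + d))
    rw [LinearMap.comp_apply, Module.End.pow_apply,
      he.divDiff_iterate_derivative (by omega) fun v hv => by
        obtain ⟨l, _, rfl⟩ := mem_nodes.1 hv; exact hG' l] at h1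
    have h2 : divDiff T (e * (X - C x) ^ p) = (∑ j ∈ Finset.range n, α j *
        divDiff (nodes t (Finset.Ico j (j + (p + d) + 2))) (e * (X - C x) ^ (p + d)))
          / (p + d).descFactorial d := by
      rw [eq_div_iff hD.ne', mul_comm, h1]
    rw [h2, Finset.sum_div, Finset.mul_sum]
    refine Finset.sum_congr rfl fun j hj => ?_
    rw [coxDeBoor_eq_divDiff he hmono hG hx (p + d) j le_rfl]
    have := sub_pos.2 (ht j (Finset.mem_range.1 hj))
    field_simp

/-- As a function of `x`, `L (e * (X - C x) ^ q)` is a polynomial whose coefficients are nonzero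
multiples of the `L (e * X ^ a)`, `a ≤ q`. Infinitely many zeros make all of them vanish. -/
lemma apply_mul_eq_zero_of_infinite {L : ℝ[X] →ₗ[ℝ] ℝ} {e h : ℝ[X]} {q : ℕ} {s : Set ℝ}
    (hs : s.Infinite) (hL : ∀ x ∈ s, L (e * (X - C x) ^ q) = 0) (hh : h.natDegree ≤ q) :
    L (e * h) = 0 := by
  set P : ℝ[X] := ∑ a ∈ Finset.range (q + 1),
    monomial a (((-1) ^ a * q.choose a) * L (e * X ^ (q - a))) with hP
  have hPe : ∀ x, P.eval x = L (e * (X - C x) ^ q) := by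
    intro x
    rw [sub_eq_neg_add, add_pow, Finset.mul_sum, map_sum, hP, eval_finsetSum]
    refine Finset.sum_congr rfl fun a _ => ?_
    have : e * ((-C x) ^ a * X ^ (q - a) * (q.choose a : ℝ[X]))
        = ((-x) ^ a * q.choose a) • (e * X ^ (q - a)) := by
      rw [smul_eq_C_mul]; simp; ring
    rw [this, map_smul, eval_monomial, smul_eq_mul, neg_pow x]
    ring
  have hP0 : P = 0 := P.eq_zero_of_infinite_isRoot
    (hs.mono fun x hx => (hPe x).trans (hL x hx))
  have hX : ∀ a ≤ q, L (e * X ^ a) = 0 := by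
    intro a ha
    have h1 := congrArg (fun p => p.coeff (q - a)) hP0
    simp only [hP, finsetSum_coeff, coeff_monomial, coeff_zero] at h1
    rw [Finset.sum_ite_eq' _ (q - a), if_pos (Finset.mem_range.2 (by omega)),
      show q - (q - a) = a by omega] at h1
    refine (mul_eq_zero.1 h1).resolve_left (mul_ne_zero (pow_ne_zero _ (by norm_num)) ?_)
    exact_mod_cast (Nat.choose_pos (by omega)).ne'
  rw [as_sum_range_C_mul_X_pow' h (Nat.lt_succ_of_le hh), Finset.mul_sum, map_sum]
  refine Finset.sum_eq_zero fun a ha => ?_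
  rw [mul_left_comm, ← smul_eq_C_mul, map_smul, hX a (by simpa [Nat.lt_succ_iff] using ha), smul_zero]

/-- The B-splines on one knot span are dual to the truncated powers `e * ∏ (X - t (j + l))`. -/
lemma IsCut.divDiff_dual {c : ℝ} {M : ℕ} {e : ℝ[X]} (he : IsCut G c M e) (hmono : Monotone t)
    (hG : ∀ i, t i ∈ G) {q j l : ℕ} (hq : q + 2 ≤ M) (hl : t l ≤ c) (hl' : c < t (l + 1))
    (hjl : j ≤ l) (hlj : l ≤ j + q) (i : ℕ) :
    (t (i + q + 1) - t i) * divDiff (nodes t (Finset.Ico i (i + q + 2)))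
      (e * nodal (nodes t (Finset.Ico (j + 1) (j + q + 1)))) = if i = j then 1 else 0 := by
  set ψ := nodal (nodes t (Finset.Ico (j + 1) (j + q + 1))) with hψ
  have hψd : ψ.natDegree = q := by
    rw [hψ, natDegree_nodal, card_nodes, Nat.card_Ico]; omega
  have hψdeg : ψ.degree = q := by
    rw [degree_eq_natDegree (nodal_monic _).ne_zero, hψd]
  have sub : ∀ {u v : ℕ}, j + 1 ≤ u → v ≤ j + q + 1 → nodal (nodes t (Finset.Ico u v)) ∣ ψ :=
    fun hu hv => nodal_dvd_nodal (Multiset.map_le_map (Finset.val_le_iff.2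
      (Finset.Ico_subset_Ico hu hv)))
  have left : ∀ {u v : ℕ}, v ≤ u + M → v ≤ l + 1 → nodal (nodes t (Finset.Ico u v)) ∣ e := by
    intro u v huv hv
    refine he.left _ (by simp; omega) fun y hy => ?_
    obtain ⟨k, hk, rfl⟩ := mem_nodes.1 hy
    rw [Finset.mem_Ico] at hk
    exact ⟨hG k, (hmono (by omega)).trans hl⟩
  have right : ∀ {u v : ℕ}, v ≤ u + M → l + 1 ≤ u → nodal (nodes t (Finset.Ico u v)) ∣ e - 1 := by
    intro u v huv hu
    refine he.right _ (by simp; omega) fun y hy => ?_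
    obtain ⟨k, hk, rfl⟩ := mem_nodes.1 hy
    rw [Finset.mem_Ico] at hk
    exact ⟨hG k, hl'.trans_le (hmono (by omega))⟩
  have split : ∀ {u v w : ℕ}, u ≤ v → v ≤ w → nodal (nodes t (Finset.Ico u w))
      = nodal (nodes t (Finset.Ico u v)) * nodal (nodes t (Finset.Ico v w)) := by
    intro u v w huv hvw
    rw [← nodal_add]
    congr 1
    rw [nodes, nodes, nodes, ← Multiset.map_add, ← Finset.Ico_union_Ico_eq_Ico huv hvw,
      ← Finset.disjUnion_eq_union _ _ (Finset.Ico_disjoint_Ico_consecutive u v w),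
      Finset.disjUnion_val]
  -- right nodes are roots of `ψ`
  have zero_of_right : ∀ {u w : ℕ}, w ≤ u + M → u ≤ w → w ≤ j + q + 1 →
      divDiff (nodes t (Finset.Ico u w)) (e * ψ) = 0 := by
    intro u w huw huw' hw
    refine divDiff_eq_zero_of_dvd ?_
    rcases le_total w (l + 1) with h | h
    · exact (left huw h).mul_right _
    rcases le_total u (l + 1) with h' | h'
    · rw [split h' h]
      exact mul_dvd_mul (left (by omega) le_rfl) (sub (by omega) hw)
    · exact (sub (by omega) hw).mul_left _
  -- left nodes are roots of `ψ`
  have coeff_of_left : ∀ {u w : ℕ}, w ≤ u + M → u + q + 1 ≤ w → j + 1 ≤ u →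
      divDiff (nodes t (Finset.Ico u w)) (e * ψ) = ψ.coeff (w - u - 1) := by
    intro u w huw huw' hu
    rw [← Nat.card_Ico u w, ← card_nodes t, ← divDiff_eq_coeff (T := nodes t (Finset.Ico u w))]
    swap
    · rw [hψdeg, card_nodes, Nat.card_Ico]
      exact_mod_cast (by omega : q < w - u)
    refine divDiff_congr ?_
    rw [show e * ψ - ψ = ψ * (e - 1) by ring]
    rcases le_total w (l + 1) with h | h
    · exact (sub (by omega) (by omega)).mul_right _
    rcases le_total u (l + 1) with h' | h'
    · rw [split h' h]
      exact mul_dvd_mul (sub (by omega) (by omega)) (right (by omega) le_rfl)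
    · exact (right huw h').mul_left _
  -- For `i < j` the nodes are roots of `e` or of `ψ`. For `i > j` the coefficient of `ψ` above its
  -- degree appears. For `i = j` the exchange rule leaves the leading coefficient of `ψ` minus zero.
  rcases lt_trichotomy i j with h | rfl | h
  · rw [if_neg h.ne, zero_of_right (by omega) (by omega) (by omega), mul_zero]
  · rw [if_pos rfl, nodes_Ico_left t (by omega : i < i + q + 2),
      show i + q + 2 = i + q + 1 + 1 by omega,
      nodes_Ico_right t (by omega : i + 1 ≤ i + q + 1), divDiff_exchange,
      ← nodes_Ico_right t (by omega : i + 1 ≤ i + q + 1),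
      ← nodes_Ico_left t (by omega : i < i + q + 1),
      zero_of_right (u := i) (by omega) (by omega) (by omega),
      coeff_of_left (u := i + 1) (by omega) (by omega) (by omega), sub_zero,
      show i + q + 1 + 1 - (i + 1) - 1 = q by omega]
    have := (nodal_monic (nodes t (Finset.Ico (i + 1) (i + q + 1)))).coeff_natDegree
    rwa [← hψ, hψd] at this
  · rw [if_neg h.ne', coeff_of_left (by omega) (by omega) (by omega),
      coeff_eq_zero_of_natDegree_lt (by omega), mul_zero]

/-- Local linear independence of B-splines. -/
lemma coeff_eq_zero_of_sum_coxDeBoor_eq_zero (hmono : Monotone t) (hG : ∀ i, t i ∈ G)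
    {q n j l : ℕ} {c : ℝ} {s : Set ℝ} (hs : s.Infinite) (hspan : ∀ x ∈ s, IsSpan t x c)
    {m : ℕ → ℝ} (hsum : ∀ x ∈ s, ∑ i ∈ Finset.range n, m i * coxDeBoor t q i x = 0)
    (hl : t l ≤ c) (hl' : c < t (l + 1)) (hjl : j ≤ l) (hlj : l ≤ j + q) (hj : j < n) :
    m j = 0 := by
  obtain ⟨e, he⟩ := exists_isCut G c (q + 2)
  set L : ℝ[X] →ₗ[ℝ] ℝ := ∑ i ∈ Finset.range n,
    (m i * (t (i + q + 1) - t i)) • divDiff (nodes t (Finset.Ico i (i + q + 2))) with hL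
  have hLapp : ∀ g, L g = ∑ i ∈ Finset.range n, m i * ((t (i + q + 1) - t i) *
      divDiff (nodes t (Finset.Ico i (i + q + 2))) g) := by
    intro g
    rw [hL, LinearMap.sum_apply]
    exact Finset.sum_congr rfl fun i _ => by rw [LinearMap.smul_apply, smul_eq_mul, mul_assoc]
  -- `L` vanishes on `e` times every polynomial of degree at most `q`; testing it on the dual
  -- polynomial isolates `m j`.
  have h0 : L (e * nodal (nodes t (Finset.Ico (j + 1) (j + q + 1)))) = 0 := by
    refine apply_mul_eq_zero_of_infinite (q := q) hs (fun x hx => ?_) ?_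
    · rw [hLapp, ← hsum x hx]
      exact Finset.sum_congr rfl fun i _ => by
        rw [coxDeBoor_eq_divDiff he hmono hG (hspan x hx) q i le_rfl]
    · rw [natDegree_nodal, card_nodes, Nat.card_Ico]; omega
  rw [hLapp] at h0
  simp only [he.divDiff_dual hmono hG le_rfl hl hl' hjl hlj] at h0
  simpa [hj] using h0

end

/-! ### The two uniform open knot vectors -/

/-- The grid point `m / (k + 1)`. -/
noncomputable def gridPoint (k m : ℕ) : ℝ := (m : ℝ) / ((k : ℝ) + 1)

lemma gridPoint_le_gridPoint {k a b : ℕ} : gridPoint k a ≤ gridPoint k b ↔ a ≤ b := by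
  have : (0 : ℝ) < (k : ℝ) + 1 := by positivity
  rw [gridPoint, gridPoint, div_le_div_iff_of_pos_right this, Nat.cast_le]

lemma gridPoint_lt_gridPoint {k a b : ℕ} : gridPoint k a < gridPoint k b ↔ a < b :=
  lt_iff_lt_of_le_iff_le gridPoint_le_gridPoint

lemma gridPoint_inj {k a b : ℕ} : gridPoint k a = gridPoint k b ↔ a = b := by
  simp only [le_antisymm_iff, gridPoint_le_gridPoint]

@[simp] lemma gridPoint_zero (k : ℕ) : gridPoint k 0 = 0 := by simp [gridPoint]

@[simp] lemma gridPoint_last (k : ℕ) : gridPoint k (k + 1) = 1 := by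
  have : (k : ℝ) + 1 ≠ 0 := by positivity
  simp [gridPoint, this]

/-- The points `m / (k + 1)`, `0 ≤ m ≤ k + 1`. -/
noncomputable def grid (k : ℕ) : Finset ℝ := (Finset.range (k + 2)).image (gridPoint k)

lemma gridPoint_mem_grid {k m : ℕ} (h : m ≤ k + 1) : gridPoint k m ∈ grid k :=
  Finset.mem_image_of_mem _ (Finset.mem_range.2 (by omega))

/-- Only the grid cell of `x` matters, so one `c` serves both knot vectors. The point 1 is assigned
to the last cell. -/
lemma isSpan_gridPoint {t : ℕ → ℝ} {ν : ℕ → ℕ} {k m : ℕ} {x : ℝ}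
    (ht : ∀ i, t i = gridPoint k (ν i)) (hν : ∀ i, ν i ≤ k + 1) (hm : m ≤ k)
    (hx : (gridPoint k m ≤ x ∧ x < gridPoint k (m + 1)) ∨ (m = k ∧ x = 1)) :
    IsSpan t x (gridPoint k m) := by
  intro i
  rw [ht, ht, gridPoint_le_gridPoint, gridPoint_lt_gridPoint]
  rcases hx with hx | ⟨rfl, rfl⟩
  · have h1 : ∀ a, gridPoint k a ≤ x ↔ a ≤ m := by
      intro a
      refine ⟨fun h => ?_, fun h => (gridPoint_le_gridPoint.2 h).trans hx.1⟩
      exact Nat.lt_succ_iff.1 (gridPoint_lt_gridPoint.1 (h.trans_lt hx.2))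
    have h2 : x ≠ 1 := by
      have : gridPoint k (m + 1) ≤ gridPoint k (k + 1) := gridPoint_le_gridPoint.2 (by omega)
      rw [gridPoint_last] at this
      exact (hx.2.trans_le this).ne
    rw [← not_le (a := gridPoint k (ν (i + 1))), h1, h1]
    simp [h2]
  · have h1 : (1 : ℝ) = gridPoint m (m + 1) := by simp
    rw [h1, gridPoint_le_gridPoint, gridPoint_lt_gridPoint, gridPoint_lt_gridPoint, gridPoint_inj]
    have := hν (i + 1)
    have := hν i
    simp only [and_true]
    omega

lemma exists_span {k : ℕ} {x : ℝ} (hx : x ∈ Set.Icc (0 : ℝ) 1) :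
    ∃ m ≤ k, (gridPoint k m ≤ x ∧ x < gridPoint k (m + 1)) ∨ (m = k ∧ x = 1) := by
  rcases eq_or_lt_of_le hx.2 with rfl | h
  · exact ⟨k, le_rfl, Or.inr ⟨rfl, rfl⟩⟩
  · have hk : (0 : ℝ) < (k : ℝ) + 1 := by positivity
    have h0 : 0 ≤ x * (k + 1) := mul_nonneg hx.1 hk.le
    refine ⟨⌊x * (k + 1)⌋₊, ?_, Or.inl ⟨?_, ?_⟩⟩
    · have : ⌊x * ((k : ℝ) + 1)⌋₊ < k + 1 := by
        rw [Nat.floor_lt h0]; push_cast; nlinarith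
      omega
    · rw [gridPoint, div_le_iff₀ hk]
      exact Nat.floor_le h0
    · rw [gridPoint, lt_div_iff₀ hk]
      push_cast
      exact Nat.lt_floor_add_one _

lemma count_nodes (t : ℕ → ℝ) (S : Finset ℕ) (z : ℝ) :
    (nodes t S).count z = (S.filter fun l => z = t l).card := by
  rw [nodes, Multiset.count_map]; rfl

lemma count_nodes_le {t : ℕ → ℝ} {S : Finset ℕ} {z : ℝ} {u v : ℕ}
    (h : ∀ l ∈ S, z = t l → u ≤ l ∧ l < v) : (nodes t S).count z ≤ v - u := by
  rw [count_nodes, ← Nat.card_Ico]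
  refine Finset.card_le_card fun l hl => ?_
  rw [Finset.mem_filter] at hl
  exact Finset.mem_Ico.2 (h l hl.1 hl.2)

lemma le_count_nodes {t : ℕ → ℝ} {S : Finset ℕ} {z : ℝ} {u v : ℕ}
    (h : ∀ l, u ≤ l → l < v → l ∈ S ∧ z = t l) : v - u ≤ (nodes t S).count z := by
  rw [count_nodes, ← Nat.card_Ico]
  refine Finset.card_le_card fun l hl => ?_
  rw [Finset.mem_Ico] at hl
  exact Finset.mem_filter.2 (h l hl.1 hl.2)

/-- The knots of maximal smoothness. -/
lemma knot_simple (r k l : ℕ) :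
    knot (r + 1) r k l = gridPoint k (min (l - (r + 1)) (k + 1)) := by
  rw [knot, Nat.add_sub_cancel_left]
  split_ifs with h1 h2
  · simp [Nat.sub_eq_zero_of_le h1]
  · rw [min_eq_left (by omega), gridPoint, Nat.div_one,
      show l - (r + 1 + 1) + 1 = l - (r + 1) by omega]
  · rw [min_eq_right (by omega), gridPoint_last]

/-- The knots of degree `2 s + 1` and smoothness `s`. -/
lemma knot_hermite (s k j : ℕ) :
    knot (2 * s + 1) s k j = gridPoint k (min (j / (s + 1) - 1) (k + 1)) := by
  -- Indices fall into blocks of length `s + 1`: the knot 0 fills two blocks and each inner knot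
  -- one. Truncated subtraction merges the first two blocks.
  rw [knot, show 2 * s + 1 - s = s + 1 by omega]
  split_ifs with h1 h2
  · have : j / (s + 1) ≤ 1 := by
      rw [← Nat.lt_succ_iff, Nat.div_lt_iff_lt_mul (by omega)]; omega
    simp [Nat.sub_eq_zero_of_le this]
  · have h3 : j / (s + 1) = (j - (2 * s + 1 + 1)) / (s + 1) + 2 := by
      rw [← Nat.add_mul_div_right _ _ (by omega : 0 < s + 1)]
      congr 1; omega
    have h4 : (j - (2 * s + 1 + 1)) / (s + 1) < k := by
      rw [Nat.div_lt_iff_lt_mul (by omega)]; omega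
    rw [h3, min_eq_left (by omega), gridPoint]
    rfl
  · have : k + 2 ≤ j / (s + 1) := by
      rw [Nat.le_div_iff_mul_le (by omega)]
      have : (k + 2) * (s + 1) = k * (s + 1) + 2 * s + 2 := by ring
      omega
    rw [min_eq_right (by omega), gridPoint_last]

lemma knot_simple_mono (r k : ℕ) : Monotone (knot (r + 1) r k) := by
  intro a b h
  rw [knot_simple, knot_simple, gridPoint_le_gridPoint]
  omega

lemma knot_hermite_mono (s k : ℕ) : Monotone (knot (2 * s + 1) s k) := by
  intro a b h
  rw [knot_hermite, knot_hermite, gridPoint_le_gridPoint]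
  have := Nat.div_le_div_right (c := s + 1) h
  omega

lemma knot_simple_mem_grid (r k l : ℕ) : knot (r + 1) r k l ∈ grid k := by
  rw [knot_simple]; exact gridPoint_mem_grid (min_le_right _ _)

lemma knot_hermite_mem_grid (s k j : ℕ) : knot (2 * s + 1) s k j ∈ grid k := by
  rw [knot_hermite]; exact gridPoint_mem_grid (min_le_right _ _)

lemma exists_isSpan {k : ℕ} (r s : ℕ) {x : ℝ} (hx : x ∈ Set.Icc (0 : ℝ) 1) :
    ∃ m ≤ k, IsSpan (knot (r + 1) r k) x (gridPoint k m) ∧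
      IsSpan (knot (2 * s + 1) s k) x (gridPoint k m) := by
  obtain ⟨m, hm, h⟩ := exists_span (k := k) hx
  exact ⟨m, hm, isSpan_gridPoint (knot_simple r k) (fun _ => min_le_right _ _) hm h,
    isSpan_gridPoint (knot_hermite s k) (fun _ => min_le_right _ _) hm h⟩

lemma num_simple (r k : ℕ) : num (r + 1) r k = r + 2 + k := by
  rw [num, Nat.add_sub_cancel_left]; ring

lemma num_hermite (s k : ℕ) : num (2 * s + 1) s k = (k + 2) * (s + 1) := by
  rw [num, show 2 * s + 1 - s = s + 1 by omega]; ring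

lemma knot_hermite_eq {s k j m : ℕ} (hm : m ≤ k + 1) (h1 : (m + 1) * (s + 1) ≤ j)
    (h2 : j < (m + 2) * (s + 1)) : knot (2 * s + 1) s k j = gridPoint k m := by
  have : j / (s + 1) = m + 1 := Nat.div_eq_of_lt_le h1 h2
  rw [knot_hermite, this]; congr 1; omega

lemma knot_hermite_eq_zero {s k j : ℕ} (h : j < 2 * s + 2) : knot (2 * s + 1) s k j = 0 := by
  rw [knot, if_pos (by omega)]

lemma knot_hermite_eq_one {s k j : ℕ} (h : (k + 2) * (s + 1) ≤ j) :
    knot (2 * s + 1) s k j = 1 := by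
  have : k + 2 ≤ j / (s + 1) := (Nat.le_div_iff_mul_le (by omega)).2 h
  rw [knot_hermite, min_eq_right (by omega), gridPoint_last]

lemma sum_N_simple (r k : ℕ) {x : ℝ} (hx : x ∈ Set.Icc (0 : ℝ) 1) :
    ∑ i ∈ Finset.range (num (r + 1) r k), N (r + 1) r k i x = 1 := by
  obtain ⟨m, hm, h, -⟩ := exists_isSpan (k := k) r 0 hx
  obtain ⟨e, he⟩ := exists_isCut (grid k) (gridPoint k m) (r + 3)
  refine sum_coxDeBoor_eq_one he (knot_simple_mono r k) (knot_simple_mem_grid r k) h le_rfl ?_ ?_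
  · rw [knot_simple, gridPoint_le_gridPoint]; omega
  · rw [knot_simple, num_simple, gridPoint_lt_gridPoint]; omega

lemma sum_N_hermite (s k : ℕ) {x : ℝ} (hx : x ∈ Set.Icc (0 : ℝ) 1) :
    ∑ j ∈ Finset.range (num (2 * s + 1) s k), N (2 * s + 1) s k j x = 1 := by
  obtain ⟨m, hm, -, h⟩ := exists_isSpan (k := k) 0 s hx
  obtain ⟨e, he⟩ := exists_isCut (grid k) (gridPoint k m) (2 * s + 1 + 2)
  refine sum_coxDeBoor_eq_one he (knot_hermite_mono s k) (knot_hermite_mem_grid s k) h le_rfl ?_ ?_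
  · rw [knot_hermite_eq_zero (by omega), ← gridPoint_zero k, gridPoint_le_gridPoint]; omega
  · rw [num_hermite, knot_hermite_eq_one le_rfl, ← gridPoint_last k, gridPoint_lt_gridPoint]; omega

/-- Linear independence of the B-splines of degree `2 s + 1` and smoothness `s` on `[0, 1]`. -/
lemma coeff_eq_zero_of_sum_N_hermite {s k : ℕ} {m : ℕ → ℝ}
    (h : ∀ x ∈ Set.Icc (0 : ℝ) 1,
      ∑ j ∈ Finset.range (num (2 * s + 1) s k), m j * N (2 * s + 1) s k j x = 0)
    {j : ℕ} (hj : j < num (2 * s + 1) s k) : m j = 0 := by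
  have hj' := hj
  rw [num_hermite] at hj'
  -- The cell starting at grid point `μ` lies in the support of the `j`-th B-spline; below, `l` is
  -- the index of the last knot at its left end.
  set μ := j / (s + 1) - 1 with hμ
  have hb : j / (s + 1) < k + 2 := (Nat.div_lt_iff_lt_mul (by omega)).2 hj'
  have h0 := Nat.zero_le (j / (s + 1))
  have hmul : (j / (s + 1)) * (s + 1) ≤ j := Nat.div_mul_le_self _ _
  have hlt : j < (j / (s + 1) + 1) * (s + 1) := Nat.lt_mul_of_div_lt (Nat.lt_succ_self _) (by omega)
  have h1 : μ * (s + 1) ≤ j :=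
    (Nat.mul_le_mul_right (s + 1) (by omega : μ ≤ j / (s + 1))).trans hmul
  have h2 : j < (μ + 2) * (s + 1) :=
    hlt.trans_le (Nat.mul_le_mul_right (s + 1) (by omega))
  have h3 : (μ + 2) * (s + 1) = μ * (s + 1) + 2 * s + 2 := by ring
  obtain ⟨l, hl⟩ : ∃ l, (μ + 2) * (s + 1) = l + 1 := ⟨(μ + 2) * (s + 1) - 1, by omega⟩
  have hsub : Set.Ico (gridPoint k μ) (gridPoint k (μ + 1)) ⊆ Set.Icc (0 : ℝ) 1 := by
    rw [← gridPoint_zero k, ← gridPoint_last k]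
    exact Set.Ico_subset_Icc_self.trans (Set.Icc_subset_Icc
      (gridPoint_le_gridPoint.2 (by omega)) (gridPoint_le_gridPoint.2 (by omega)))
  refine coeff_eq_zero_of_sum_coxDeBoor_eq_zero (t := knot (2 * s + 1) s k) (q := 2 * s + 1)
    (l := l) (c := gridPoint k μ) (knot_hermite_mono s k) (knot_hermite_mem_grid s k)
    (Set.Ico_infinite (gridPoint_lt_gridPoint.2 (Nat.lt_succ_self μ)))
    (fun x hx => isSpan_gridPoint (knot_hermite s k) (fun _ => min_le_right _ _) (by omega)
      (Or.inl hx)) (fun x hx => h x (hsub hx)) ?_ ?_ (by omega) (by omega) hj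
  · have : l / (s + 1) < μ + 2 := (Nat.div_lt_iff_lt_mul (by omega)).2 (by omega)
    rw [knot_hermite, gridPoint_le_gridPoint]; omega
  · have : μ + 2 ≤ (l + 1) / (s + 1) := (Nat.le_div_iff_mul_le (by omega)).2 (by omega)
    rw [knot_hermite, gridPoint_lt_gridPoint]; omega

/-! ### The range of the coefficients of the expansion -/

/-- The index of the first knot of degree `2 s + 1` that matters for the `i`-th B-spline of
degree `p`. -/
def firstKnot (s p i : ℕ) : ℕ := if i ≤ p then i else (i - p + 1) * (s + 1)

/-- The first index past the knots of degree `2 s + 1` that matter for the `i`-th B-spline of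
degree `p`. -/
def endKnot (s p k i : ℕ) : ℕ :=
  if i < k then (i + 3) * (s + 1) else (k + 2) * (s + 1) + (i + 2 * s + 2 - k - p)

/-- Raising the degree from `r + 1` to `2 s + 1` costs `2 s - r` additional copies of each knot. An
inner knot has `s + 1 ≥ 1 + (2 s - r)` copies available, as `s ≤ r`; at 0 and 1 the index bounds
keep exactly as many copies as needed, which makes the support sharp enough for the truncation. -/
lemma count_knots_le {s r k i : ℕ} (hr : s ≤ r) (hr' : r ≤ 2 * s) (hi : i < r + 2 + k) :
    ∀ z ∈ nodes (knot (r + 1) r k) (Finset.Ico i (i + (r + 1) + 2)),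
      (nodes (knot (r + 1) r k) (Finset.Ico i (i + (r + 1) + 2))).count z + (2 * s + 1 - (r + 1))
        ≤ (nodes (knot (2 * s + 1) s k)
          (Finset.Ico (firstKnot s (r + 1) i) (endKnot s (r + 1) k i))).count z := by
  intro z hz
  obtain ⟨l, hl, rfl⟩ := mem_nodes.1 hz
  rw [Finset.mem_Ico] at hl
  have hfirst : ∀ m, 1 ≤ m → i ≤ m + (r + 1) → firstKnot s (r + 1) i ≤ (m + 1) * (s + 1) := by
    intro m hm him
    rw [firstKnot]
    split_ifs with h
    · have := Nat.mul_le_mul_right (s + 1) (by omega : 2 ≤ m + 1)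
      omega
    · exact Nat.mul_le_mul_right (s + 1) (by omega)
  have hend : ∀ m, m ≤ k → m ≤ i + 1 → (m + 2) * (s + 1) ≤ endKnot s (r + 1) k i := by
    intro m hm him
    rw [endKnot]
    split_ifs with h
    · exact Nat.mul_le_mul_right (s + 1) (by omega)
    · exact (Nat.mul_le_mul_right (s + 1) (by omega : m + 2 ≤ k + 2)).trans (Nat.le_add_right _ _)
  have hT : ∀ {u v : ℕ}, (∀ l' ∈ Finset.Ico i (i + (r + 1) + 2),
      min (l - (r + 1)) (k + 1) = min (l' - (r + 1)) (k + 1) → u ≤ l' ∧ l' < v) →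
      (nodes (knot (r + 1) r k) (Finset.Ico i (i + (r + 1) + 2))).count (knot (r + 1) r k l)
        ≤ v - u := fun h => count_nodes_le fun l' hl' he =>
    h l' hl' (by rwa [knot_simple, knot_simple, gridPoint_inj] at he)
  rcases le_or_gt l (r + 1) with h1 | h1
  · have hc := hT (u := i) (v := r + 2) fun l' hl' he => by
      rw [Finset.mem_Ico] at hl'; omega
    have hf : 2 * s + 2 - i ≤ _ := le_count_nodes (t := knot (2 * s + 1) s k)
      (S := Finset.Ico (firstKnot s (r + 1) i) (endKnot s (r + 1) k i))
      (z := knot (r + 1) r k l) fun j hj hj' => by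
        have := hend 0 (by omega) (by omega)
        refine ⟨Finset.mem_Ico.2 ⟨?_, by omega⟩, ?_⟩
        · rw [firstKnot, if_pos (by omega)]; exact hj
        · rw [knot_hermite_eq_zero hj', knot, if_pos h1]
    omega
  rcases le_or_gt l (r + 1 + k) with h2 | h2
  · have hc := hT (u := l) (v := l + 1) fun l' hl' he => by
      rw [Finset.mem_Ico] at hl'; omega
    obtain ⟨m, rfl⟩ := Nat.exists_eq_add_of_le h1.le
    have hf : (m + 2) * (s + 1) - (m + 1) * (s + 1) ≤ _ :=
      le_count_nodes (t := knot (2 * s + 1) s k)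
      (S := Finset.Ico (firstKnot s (r + 1) i) (endKnot s (r + 1) k i))
      (z := knot (r + 1) r k (r + 1 + m)) fun j hj hj' => by
        have h3 := hend m (by omega) (by omega)
        have h4 := hfirst m (by omega) (by omega)
        refine ⟨Finset.mem_Ico.2 ⟨by omega, by omega⟩, ?_⟩
        rw [knot_hermite_eq (by omega) hj hj', knot_simple]
        congr 1; omega
    have : (m + 2) * (s + 1) - (m + 1) * (s + 1) = s + 1 := by
      rw [← Nat.sub_mul, show m + 2 - (m + 1) = 1 by omega, one_mul]
    omega
  · have hc := hT (u := r + 2 + k) (v := i + r + 3) fun l' hl' he => by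
      rw [Finset.mem_Ico] at hl'; omega
    have hb : endKnot s (r + 1) k i = (k + 2) * (s + 1) + (i + 2 * s + 2 - k - (r + 1)) := by
      rw [endKnot, if_neg (by omega)]
    have hf : endKnot s (r + 1) k i - (k + 2) * (s + 1) ≤ _ :=
      le_count_nodes (t := knot (2 * s + 1) s k)
      (S := Finset.Ico (firstKnot s (r + 1) i) (endKnot s (r + 1) k i))
      (z := knot (r + 1) r k l) fun j hj hj' => by
        have h4 : _ ≤ (k + 2) * (s + 1) := hfirst (k + 1) (by omega) (by omega)
        refine ⟨Finset.mem_Ico.2 ⟨by omega, hj'⟩, ?_⟩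
        rw [knot_hermite_eq_one hj, knot_simple, min_eq_right (by omega), gridPoint_last]
    omega

lemma endKnot_le {s p k i : ℕ} (hi : i < p + 1 + k) :
    endKnot s p k i ≤ (k + 2) * (s + 1) + 2 * s + 2 := by
  rw [endKnot]
  split_ifs with h
  · exact (Nat.mul_le_mul_right (s + 1) (by omega : i + 3 ≤ k + 2)).trans (by omega)
  · omega

/-- Existence of the representation of the B-splines of degree `r + 1`, with nonnegative
coefficients. -/
lemma exists_isExpansion_nonneg {s r k i : ℕ} (hr : s ≤ r) (hr' : r ≤ 2 * s)
    (hi : i < num (r + 1) r k) :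
    ∃ m, IsExpansion (r + 1) r (2 * s + 1) s k i m ∧ (∀ j, 0 ≤ m j) ∧
      ∀ j, m j ≠ 0 →
        firstKnot s (r + 1) i ≤ j ∧ j + 2 * s + 3 ≤ endKnot s (r + 1) k i := by
  rw [num_simple] at hi
  have hend := endKnot_le (s := s) (p := r + 1) (k := k)
    (by omega : i < r + 1 + 1 + k)
  have hlt : ∀ j < num (2 * s + 1) s k,
      knot (2 * s + 1) s k j < knot (2 * s + 1) s k (j + (2 * s + 1) + 1) := by
    intro j hj
    rw [num_hermite] at hj
    have h1 : j / (s + 1) < k + 2 := (Nat.div_lt_iff_lt_mul (by omega)).2 hj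
    have h2 : (j + (2 * s + 1) + 1) / (s + 1) = j / (s + 1) + 2 := by
      rw [← Nat.add_mul_div_right _ _ (by omega : 0 < s + 1)]; congr 1
    rw [knot_hermite, knot_hermite, gridPoint_lt_gridPoint, h2]
    generalize j / (s + 1) = b at *
    omega
  obtain ⟨m, h0, hsupp, hsum⟩ := exists_nonneg_expansion (knot_hermite_mono s k)
    (knot_hermite_mem_grid s k) (knot_simple_mono r k) (knot_simple_mem_grid r k)
    (by omega : r + 1 ≤ 2 * s + 1) (n := num (2 * s + 1) s k)
    (by rw [num_hermite]; omega) hlt (count_knots_le hr hr' hi)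
  refine ⟨m, ⟨fun x hx => ?_, fun j hj => ?_⟩, h0, hsupp⟩
  · obtain ⟨l, -, h1, h2⟩ := exists_isSpan (k := k) r s hx
    exact hsum x _ h2 h1
  · by_contra h
    have := hsupp j h
    rw [num_hermite] at hj
    omega

lemma IsExpansion.unique {p r s k i : ℕ} {c c' : ℕ → ℝ}
    (h : IsExpansion p r (2 * s + 1) s k i c) (h' : IsExpansion p r (2 * s + 1) s k i c') :
    c = c' := by
  funext j
  rcases lt_or_ge j (num (2 * s + 1) s k) with hj | hj
  · refine sub_eq_zero.1 (coeff_eq_zero_of_sum_N_hermite (m := fun j => c j - c' j)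
      (fun x hx => ?_) hj)
    simp only [sub_mul, Finset.sum_sub_distrib]
    rw [← h.1 x hx, ← h'.1 x hx, sub_self]
  · rw [h.2 j hj, h'.2 j hj]

/-! ### Coefficients and truncated B-splines -/

section
variable {s r k i : ℕ}

lemma isExpansion_mu (hr : s ≤ r) (hr' : r ≤ 2 * s) (hi : i < num (r + 1) r k) :
    IsExpansion (r + 1) r (2 * s + 1) s k i (mu (r + 1) r (2 * s + 1) s k i) := by
  obtain ⟨m, hm, -⟩ := exists_isExpansion_nonneg hr hr' hi
  have h : ∃ c, IsExpansion (r + 1) r (2 * s + 1) s k i c := ⟨m, hm⟩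
  rw [mu, dif_pos h]
  exact h.choose_spec

/-- By uniqueness, the chosen coefficients are the nonnegative ones constructed from divided
differences. -/
lemma mu_nonneg (hr : s ≤ r) (hr' : r ≤ 2 * s) (hi : i < num (r + 1) r k) (j : ℕ) :
    0 ≤ mu (r + 1) r (2 * s + 1) s k i j := by
  obtain ⟨m, hm, h0, -⟩ := exists_isExpansion_nonneg hr hr' hi
  rw [(isExpansion_mu hr hr' hi).unique hm]
  exact h0 j

lemma mu_support (hr : s ≤ r) (hr' : r ≤ 2 * s) (hi : i < num (r + 1) r k) {j : ℕ}
    (hj : mu (r + 1) r (2 * s + 1) s k i j ≠ 0) :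
    firstKnot s (r + 1) i ≤ j ∧ j + 2 * s + 3 ≤ endKnot s (r + 1) k i := by
  obtain ⟨m, hm, -, hsupp⟩ := exists_isExpansion_nonneg hr hr' hi
  rw [(isExpansion_mu hr hr' hi).unique hm] at hj
  exact hsupp j hj

/-- Both families sum to 1 on `[0,1]`, so linear independence allows comparing coefficients. -/
lemma sum_mu (hr : s ≤ r) (hr' : r ≤ 2 * s) {j : ℕ} (hj : j < num (2 * s + 1) s k) :
    ∑ i ∈ Finset.range (num (r + 1) r k), mu (r + 1) r (2 * s + 1) s k i j = 1 := by
  refine sub_eq_zero.1 (coeff_eq_zero_of_sum_N_hermite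
    (m := fun j => ∑ i ∈ Finset.range (num (r + 1) r k), mu (r + 1) r (2 * s + 1) s k i j - 1)
    (fun x hx => ?_) hj)
  simp only [sub_mul, Finset.sum_sub_distrib, one_mul, Finset.sum_mul]
  rw [sum_N_hermite s k hx, Finset.sum_comm, sub_eq_zero, ← sum_N_simple r k hx]
  exact Finset.sum_congr rfl fun i hi =>
    ((isExpansion_mu hr hr' (Finset.mem_range.1 hi)).1 x hx).symm

/-- The truncation does not change the inner B-splines. -/
lemma Ntrunc_eq_N (hr : s ≤ r) (hr' : r ≤ 2 * s) (h1 : s + 1 ≤ i)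
    (h2 : i + s + 2 ≤ num (r + 1) r k) {x : ℝ} (hx : x ∈ Set.Icc (0 : ℝ) 1) :
    Ntrunc s (r + 1) r (2 * s + 1) s k i x = N (r + 1) r k i x := by
  have hi : i < num (r + 1) r k := by omega
  rw [(isExpansion_mu hr hr' hi).1 x hx, Ntrunc]
  have hn : 2 * s + 2 ≤ num (2 * s + 1) s k := by rw [num]; omega
  refine Finset.sum_subset (fun j hj => ?_) (fun j _ hj => ?_)
  · rw [Finset.mem_Icc] at hj
    rw [Finset.mem_range]; omega
  · refine mul_eq_zero_of_left ?_ _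
    by_contra hne
    obtain ⟨ha, hb⟩ := mu_support hr hr' hi hne
    refine hj (Finset.mem_Icc.2 ⟨?_, ?_⟩)
    · rw [firstKnot] at ha
      split_ifs at ha with h
      · omega
      · have := Nat.mul_le_mul_right (s + 1) (by omega : 1 ≤ i - (r + 1) + 1)
        omega
    · rw [num_simple] at h2
      rw [num_hermite]
      rw [endKnot] at hb
      split_ifs at hb with h
      · have := Nat.mul_le_mul_right (s + 1) (by omega : i + 3 ≤ k + 2)
        omega
      · omega

/-- For `i = 0` the support bounds force `j ≤ s`; for the last index they force `j ≥ (k + 1) * (s +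
1) = n₂ - s - 1`. Both ranges are removed by the truncation. -/
lemma mu_boundary (hr : s ≤ r) (hr' : r ≤ 2 * s) (hk : 1 ≤ k)
    (hi : i = 0 ∨ i + 1 = num (r + 1) r k) {j : ℕ}
    (hj : j ∈ Finset.Icc (s + 1) (num (2 * s + 1) s k - s - 2)) :
    mu (r + 1) r (2 * s + 1) s k i j = 0 := by
  have hi' : i < num (r + 1) r k := by rw [num_simple] at *; omega
  by_contra hne
  obtain ⟨ha, hb⟩ := mu_support hr hr' hi' hne
  rw [Finset.mem_Icc, num_hermite] at hj
  rw [num_simple] at hi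
  rcases hi with rfl | hi
  · rw [endKnot, if_pos (by omega)] at hb
    omega
  · rw [firstKnot, if_neg (by omega), show i - (r + 1) + 1 = k + 1 by omega] at ha
    have : (k + 2) * (s + 1) = (k + 1) * (s + 1) + s + 1 := by ring
    omega

/-- After exchanging the sums, each column of coefficients adds up to 1: the two omitted indices
contribute nothing. -/
lemma sum_Ntrunc (hr : s ≤ r) (hr' : r ≤ 2 * s) (hk : 1 ≤ k) (x : ℝ) :
    ∑ i ∈ Finset.Icc 1 (num (r + 1) r k - 2), Ntrunc s (r + 1) r (2 * s + 1) s k i x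
      = ∑ j ∈ Finset.Icc (s + 1) (num (2 * s + 1) s k - s - 2), N (2 * s + 1) s k j x := by
  simp only [Ntrunc]
  rw [Finset.sum_comm]
  refine Finset.sum_congr rfl fun j hj => ?_
  have hn : 2 * s + 2 ≤ num (2 * s + 1) s k := by rw [num]; omega
  have hj' := Finset.mem_Icc.1 hj
  rw [← Finset.sum_mul]
  refine (congrArg (· * N (2 * s + 1) s k j x) ?_).trans (one_mul _)
  rw [← sum_mu hr hr' (by omega : j < num (2 * s + 1) s k)]
  refine Finset.sum_subset (fun i hi => ?_) (fun i hi hi' => ?_)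
  · rw [Finset.mem_Icc] at hi
    rw [Finset.mem_range]; omega
  · rw [Finset.mem_range] at hi
    refine mu_boundary hr hr' hk ?_ hj
    by_contra h
    push Not at h
    exact hi' (Finset.mem_Icc.2 (by omega))

lemma Ntrunc_nonneg (hr : s ≤ r) (hr' : r ≤ 2 * s) (hi : i < num (r + 1) r k) (x : ℝ) :
    0 ≤ Ntrunc s (r + 1) r (2 * s + 1) s k i x :=
  Finset.sum_nonneg fun j _ => mul_nonneg (mu_nonneg hr hr' hi j)
    (coxDeBoor_nonneg (knot_hermite_mono s k) _ _ _)

/-- Each B-spline with nonzero coefficient is itself supported in the knot interval of the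
untruncated one, so dropping terms cannot enlarge the support. -/
lemma Ntrunc_eq_zero (hr : s ≤ r) (hr' : r ≤ 2 * s) (hi : i < num (r + 1) r k) {x : ℝ}
    (hx : x ∉ Set.Icc (knot (r + 1) r k i) (knot (r + 1) r k (i + (r + 1) + 1))) :
    Ntrunc s (r + 1) r (2 * s + 1) s k i x = 0 := by
  refine Finset.sum_eq_zero fun j _ => ?_
  by_cases hne : mu (r + 1) r (2 * s + 1) s k i j = 0
  · rw [hne, zero_mul]
  obtain ⟨ha, hb⟩ := mu_support hr hr' hi hne
  rw [num_simple] at hi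
  refine mul_eq_zero_of_right _ (coxDeBoor_eq_zero (knot_hermite_mono s k) _ _
    fun h => hx (Set.Icc_subset_Icc ?_ ?_ h))
  · rw [firstKnot] at ha
    split_ifs at ha with h
    · rw [knot_simple, show i - (r + 1) = 0 by omega, knot_hermite, gridPoint_le_gridPoint]
      omega
    · have : i - (r + 1) + 1 ≤ j / (s + 1) := (Nat.le_div_iff_mul_le (by omega)).2 ha
      rw [knot_simple, knot_hermite, gridPoint_le_gridPoint]
      omega
  · rw [endKnot] at hb
    rw [knot_simple, knot_hermite, gridPoint_le_gridPoint]
    split_ifs at hb with h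
    · have : (j + (2 * s + 1) + 1) / (s + 1) < i + 3 :=
        (Nat.div_lt_iff_lt_mul (by omega)).2 (by omega)
      omega
    · omega

end

/-! ### Tensor products and the sum over all basis functions -/

lemma hasLocalSupport_mul {p r k : ℕ} {j : ℕ × ℕ} {f g : ℝ → ℝ}
    (hf : ∀ x ∉ Set.Icc (knot p r k j.1) (knot p r k (j.1 + p + 1)), f x = 0)
    (hg : ∀ x ∉ Set.Icc (knot p r k j.2) (knot p r k (j.2 + p + 1)), g x = 0)
    (hlen : ∀ i, knot p r k (i + p + 1) - knot p r k i ≤ ((p : ℝ) + 1) / ((k : ℝ) + 1)) :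
    HasLocalSupport p r k j fun x => f x.1 * g x.2 := by
  refine ⟨closure_minimal (fun x hx => ?_) (isClosed_Icc.prod isClosed_Icc), hlen _, hlen _⟩
  rw [Function.mem_support] at hx
  exact ⟨by_contra fun h => hx (by rw [hf _ h, zero_mul]),
    by_contra fun h => hx (by rw [hg _ h, mul_zero])⟩

lemma gridPoint_sub_le {k a b p : ℕ} (h : b ≤ a + (p + 1)) :
    gridPoint k b - gridPoint k a ≤ ((p : ℝ) + 1) / ((k : ℝ) + 1) := by
  rw [gridPoint, gridPoint, ← _root_.sub_div]
  have : (b : ℝ) ≤ a + (p + 1) := by exact_mod_cast h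
  exact div_le_div_of_nonneg_right (by linarith) (by positivity)

lemma knot_simple_sub_le (r k i : ℕ) : knot (r + 1) r k (i + (r + 1) + 1) - knot (r + 1) r k i
    ≤ (((r + 1 : ℕ) : ℝ) + 1) / ((k : ℝ) + 1) := by
  rw [knot_simple, knot_simple]
  exact gridPoint_sub_le (by omega)

lemma knot_hermite_sub_le (s k i : ℕ) :
    knot (2 * s + 1) s k (i + (2 * s + 1) + 1) - knot (2 * s + 1) s k i
      ≤ (((2 * s + 1 : ℕ) : ℝ) + 1) / ((k : ℝ) + 1) := by
  have h2 : (i + (2 * s + 1) + 1) / (s + 1) = i / (s + 1) + 2 := by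
    rw [← Nat.add_mul_div_right _ _ (by omega : 0 < s + 1)]; congr 1
  rw [knot_hermite, knot_hermite, h2]
  generalize i / (s + 1) = b
  exact gridPoint_sub_le (by omega)

lemma sum_product_mul (S : Finset ℕ) (T : Finset ℕ) (f g : ℕ → ℝ) :
    ∑ j ∈ S ×ˢ T, f j.1 * g j.2 = (∑ i ∈ S, f i) * ∑ j ∈ T, g j := by
  rw [Finset.sum_product, Finset.sum_mul_sum]

lemma disjoint_indexS1_indexTrunc (s n : ℕ) : Disjoint (indexS1 s n) (indexTrunc s n) := by
  rw [Finset.disjoint_left]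
  intro j h1 h2
  simp only [indexS1, indexTrunc, Finset.mem_union, Finset.mem_product, Finset.mem_Icc] at h1 h2
  omega

lemma indexS1_union_indexTrunc {s n : ℕ} (hs : 1 ≤ s) (hn : 2 * s + 3 ≤ n) :
    indexS1 s n ∪ indexTrunc s n = Finset.Icc 1 (n - 2) ×ˢ Finset.Icc 1 (n - 2) := by
  ext j
  simp only [indexS1, indexTrunc, Finset.mem_union, Finset.mem_product, Finset.mem_Icc]
  omega

lemma disjoint_inner_indexS2 (s n : ℕ) : Disjoint
    (Finset.Icc (s + 1) (n - s - 2) ×ˢ Finset.Icc (s + 1) (n - s - 2)) (indexS2 s n) := by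
  rw [Finset.disjoint_left]
  intro j h1 h2
  simp only [indexS2, Finset.mem_union, Finset.mem_product, Finset.mem_Icc] at h1 h2
  omega

lemma inner_union_indexS2 {s n : ℕ} (hn : 2 * s + 3 ≤ n) :
    (Finset.Icc (s + 1) (n - s - 2) ×ˢ Finset.Icc (s + 1) (n - s - 2)) ∪ indexS2 s n
      = Finset.range n ×ˢ Finset.range n := by
  ext j
  simp only [indexS2, Finset.mem_union, Finset.mem_product, Finset.mem_Icc, Finset.mem_range]
  omega

lemma sum_basisFun {s r k : ℕ} (hs : 1 ≤ s) (hr : s ≤ r) (hr' : r ≤ 2 * s) (hk : 1 ≤ k)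
    (hrk : 2 * s + 1 ≤ r + k) {x : ℝ × ℝ} (hx : x ∈ Set.Icc (0 : ℝ) 1 ×ˢ Set.Icc (0 : ℝ) 1) :
    ∑ b : BasisIndex s (r + 1) r (2 * s + 1) s k, basisFun s (r + 1) r (2 * s + 1) s k b x = 1 := by
  -- The lower bound on `k` enters here: it keeps the left and right boundary index strips apart.
  have hn1 : 2 * s + 3 ≤ num (r + 1) r k := by rw [num_simple]; omega
  have hn2 : 2 * s + 3 ≤ num (2 * s + 1) s k := by
    rw [num_hermite]
    have := Nat.mul_le_mul_right (s + 1) (by omega : 3 ≤ k + 2)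
    omega
  rw [Fintype.sum_sum_type, Fintype.sum_sum_type]
  simp only [basisFun]
  rw [Finset.sum_coe_sort (indexS1 s (num (r + 1) r k)) (fun j => N2 (r + 1) r k j x),
    Finset.sum_coe_sort (indexTrunc s (num (r + 1) r k))
      (fun j => Ntrunc2 s (r + 1) r (2 * s + 1) s k j x),
    Finset.sum_coe_sort (indexS2 s (num (2 * s + 1) s k)) (fun j => N2 (2 * s + 1) s k j x)]
  -- On the square the `S₁` generators equal their truncations, so they join the truncated functions
  -- in one full product sum.
  have h1 : ∑ j ∈ indexS1 s (num (r + 1) r k), N2 (r + 1) r k j x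
      = ∑ j ∈ indexS1 s (num (r + 1) r k), Ntrunc2 s (r + 1) r (2 * s + 1) s k j x := by
    refine Finset.sum_congr rfl fun j hj => ?_
    simp only [indexS1, Finset.mem_product, Finset.mem_Icc] at hj
    rw [N2, Ntrunc2, Ntrunc_eq_N hr hr' hj.1.1 (by omega) hx.1,
      Ntrunc_eq_N hr hr' hj.2.1 (by omega) hx.2]
  rw [h1, ← add_assoc, ← Finset.sum_union (disjoint_indexS1_indexTrunc _ _),
    indexS1_union_indexTrunc hs hn1]
  simp only [Ntrunc2]
  rw [sum_product_mul _ _ (fun i => Ntrunc s (r + 1) r (2 * s + 1) s k i x.1)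
    (fun i => Ntrunc s (r + 1) r (2 * s + 1) s k i x.2), sum_Ntrunc hr hr' hk,
    sum_Ntrunc hr hr' hk, ← sum_product_mul]
  simp only [N2]
  rw [← Finset.sum_union (disjoint_inner_indexS2 _ _), inner_union_indexS2 hn2,
    sum_product_mul _ _ (fun i => N (2 * s + 1) s k i x.1) (fun i => N (2 * s + 1) s k i x.2),
    sum_N_hermite s k hx.1, sum_N_hermite s k hx.2, one_mul]

lemma lt_of_mem_indexTrunc {s n : ℕ} (hn : 2 * s + 3 ≤ n) {j : ℕ × ℕ} (hj : j ∈ indexTrunc s n) :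
    j.1 < n ∧ j.2 < n := by
  simp only [indexTrunc, Finset.mem_union, Finset.mem_product, Finset.mem_Icc] at hj
  omega

end MixedSpline

theorem theorem2 (s k p₁ r₁ p₂ r₂ : ℕ) (hs : 1 ≤ s)
    (hp₂ : p₂ = 2 * s + 1) (hr₂ : r₂ = s) (hr₁ : r₁ + 1 = p₁)
    (hp₁ : s + 1 ≤ p₁) (hp₁' : p₁ ≤ 2 * s + 1)
    (hk : max (2 * (s + 1) - p₁) 2 ≤ k) :
    -- the coefficients that define the truncation exist and are unique
    (∀ i < MixedSpline.num p₁ r₁ k, ∃! c : ℕ → ℝ, MixedSpline.IsExpansion p₁ r₁ p₂ r₂ k i c) ∧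
    -- every basis function has local support
    (∀ b : MixedSpline.BasisIndex s p₁ r₁ p₂ r₂ k,
      MixedSpline.BasisLocalSupport s p₁ r₁ p₂ r₂ k b) ∧
    -- every basis function is nonnegative
    (∀ b : MixedSpline.BasisIndex s p₁ r₁ p₂ r₂ k,
      ∀ x ∈ Set.Icc (0 : ℝ) 1 ×ˢ Set.Icc (0 : ℝ) 1,
        0 ≤ MixedSpline.basisFun s p₁ r₁ p₂ r₂ k b x) ∧
    -- the basis functions sum to one on the unit square
    (∀ x ∈ Set.Icc (0 : ℝ) 1 ×ˢ Set.Icc (0 : ℝ) 1,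
      ∑ b : MixedSpline.BasisIndex s p₁ r₁ p₂ r₂ k,
        MixedSpline.basisFun s p₁ r₁ p₂ r₂ k b x = 1) := by

  subst hp₂ hr₂ hr₁
  have hr : r₂ ≤ r₁ := by omega
  have hr' : r₁ ≤ 2 * r₂ := by omega
  have hn1 : 2 * r₂ + 3 ≤ MixedSpline.num (r₁ + 1) r₁ k := by
    rw [MixedSpline.num_simple]; omega
  refine ⟨fun i hi => ?_, fun b => ?_, fun b x _ => ?_, fun x hx =>
    MixedSpline.sum_basisFun hs hr hr' (by omega) (by omega) hx⟩
  · exact ⟨_, MixedSpline.isExpansion_mu hr hr' hi,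
      fun c hc => hc.unique (MixedSpline.isExpansion_mu hr hr' hi)⟩
  · rcases b with j | j | j
    · exact MixedSpline.hasLocalSupport_mul
        (fun x hx => MixedSpline.coxDeBoor_eq_zero (MixedSpline.knot_simple_mono r₁ k) _ _ hx)
        (fun x hx => MixedSpline.coxDeBoor_eq_zero (MixedSpline.knot_simple_mono r₁ k) _ _ hx)
        (MixedSpline.knot_simple_sub_le r₁ k)
    · have hj := MixedSpline.lt_of_mem_indexTrunc hn1 j.2
      exact MixedSpline.hasLocalSupport_mul
        (fun x hx => MixedSpline.Ntrunc_eq_zero hr hr' hj.1 hx)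
        (fun x hx => MixedSpline.Ntrunc_eq_zero hr hr' hj.2 hx)
        (MixedSpline.knot_simple_sub_le r₁ k)
    · exact MixedSpline.hasLocalSupport_mul
        (fun x hx => MixedSpline.coxDeBoor_eq_zero (MixedSpline.knot_hermite_mono r₂ k) _ _ hx)
        (fun x hx => MixedSpline.coxDeBoor_eq_zero (MixedSpline.knot_hermite_mono r₂ k) _ _ hx)
        (MixedSpline.knot_hermite_sub_le r₂ k)
  · rcases b with j | j | j
    · exact mul_nonneg (MixedSpline.coxDeBoor_nonneg (MixedSpline.knot_simple_mono r₁ k) _ _ _)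
        (MixedSpline.coxDeBoor_nonneg (MixedSpline.knot_simple_mono r₁ k) _ _ _)
    · have hj := MixedSpline.lt_of_mem_indexTrunc hn1 j.2
      exact mul_nonneg (MixedSpline.Ntrunc_nonneg hr hr' hj.1 _)
        (MixedSpline.Ntrunc_nonneg hr hr' hj.2 _)
    · exact mul_nonneg (MixedSpline.coxDeBoor_nonneg (MixedSpline.knot_hermite_mono r₂ k) _ _ _)
        (MixedSpline.coxDeBoor_nonneg (MixedSpline.knot_hermite_mono r₂ k) _ _ _)
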